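/- **Notation.** Write $e(z)=e^{2\pi i z}$ and $q^\alpha=e(\alpha\tau)$ for $\alpha\in\mathbf R$ and $\tau$ in the upper half-plane; $\{\cdot\}$ is the fractional part and $B_2(t)=t^2-t+\frac16$. *Regularised integrals.* A $C^\infty$ function $f$ on the imaginary axis $]0,i\infty[$ is admissible at $\infty$ if $f=f^\infty+f^0$ with $f^\infty\in\mathbf C[\tau]$ and $f^0(\tau)=O(c^{\operatorname{Im}\tau})$ as $\operatorname{Im}\tau\to\infty$ for some $0<c<1$; its regularised value at $\infty$ is the constant term of $f^\infty$. A form $\omega=f\,d\tau$ is admissible at $\infty$ if $f$ is, and then $\omega^\infty=f^\infty d\tau$; it is admissible if both $\omega$ and $\omega^\sigma=\sigma^*\omega$, with $\sigma:\tau\mapsto-1/\tau$, are admissible at $\infty$. For admissible forms $\omega_1,\dots,\omega_n$ and $\tau\in\,]0,i\infty[$ put $$\int_\tau^\infty\omega_1\cdots\omega_n=\lim_{p\to i\infty}\sum_{k=0}^n\int_\tau^p\omega_1\cdots\omega_k\int_p^0\omega_{k+1}^\infty\cdots\omega_n^\infty,\qquad \int_0^\tau\omega_1\cdots\omega_n=(-1)^n\int_{-1/\tau}^\infty\omega_n^\sigma\cdots\omega_1^\sigma,$$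 $$\int_0^\infty\omega_1\cdots\omega_n=\sum_{k=0}^n\int_0^\tau\omega_1\cdots\omega_k\int_\tau^\infty\omega_{k+1}\cdots\omega_n ,$$ where $\int_\tau^p\omega_1\cdots\omega_k=\int_\tau^p\omega_1(\tau_1)\int_{\tau_1}^p\omega_2(\tau_2)\cdots$ is the usual iterated integral; the last sum is independent of $\tau$ (take $\tau=i$). *Eisenstein series and Siegel units.* For $\boldsymbol x=(x_1,x_2)\in(\mathbf R/\mathbf Z)^2\setminus\{\boldsymbol 0\}$ let $$E^{(2)}_{\boldsymbol x}(\tau)=-\frac{1}{(-2\pi i)^2}K_2(0,x_1\tau+x_2,2;\tau),\qquad \Lambda(\boldsymbol x,\boldsymbol y)=(2\pi i)^2\int_0^\infty E^{(2)}_{\boldsymbol x}(\tau)\,d\tau\;E^{(2)}_{\boldsymbol y}(\tau)\,d\tau,$$ where $K_2(0,x_0,s;\tau)$ is the analytic continuation in $s$ of $\sum_{0\ne w\in\mathbf Z+\tau\mathbf Z}\exp\!\big(\tfrac{\pi}{\operatorname{Im}\tau}(w\overline{x_0}-\overline w x_0)\big)\,\overline w^{\,2}|w|^{-2s}$ from $\operatorname{Re}s>2$.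 Let $$g_{\boldsymbol x}(\tau)=q^{B_2(\{x_1\})/2}\prod_{\substack{n\in\mathbf R_{\ge0}\\ n\equiv x_1\bmod 1}}(1-q^ne(x_2))\prod_{\substack{n\in\mathbf R_{>0}\\ n\equiv -x_1\bmod 1}}(1-q^ne(-x_2)),$$ $\omega^+_{\boldsymbol x}=\operatorname{Re}(\operatorname{dlog}g_{\boldsymbol x})$, $\omega^-_{\boldsymbol x}=\operatorname{Im}(\operatorname{dlog}g_{\boldsymbol x})=\operatorname{darg}g_{\boldsymbol x}$, $\Lambda^{\pm}(\boldsymbol x)=\int_0^\infty\omega^\pm_{\boldsymbol x}$, and $$\eta(g_{\boldsymbol a},g_{\boldsymbol b})=\log|g_{\boldsymbol a}|\operatorname{darg}g_{\boldsymbol b}-\log|g_{\boldsymbol b}|\operatorname{darg}g_{\boldsymbol a},$$ all forms being restricted to $]0,i\infty[$. For $N\ge1$, identify $(\mathbf Z/N\mathbf Z)^2$ with a subgroup of $(\mathbf R/\mathbf Z)^2$ by $(\overline{x}_1,\overline{x}_2)\mapsto(x_1/N,x_2/N)$. **Proposition.** Let $N\ge1$ and $\boldsymbol a,\boldsymbol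 b\in(\mathbf Z/N\mathbf Z)^2\setminus\{\boldsymbol 0\}$. For $\boldsymbol x\in\{\boldsymbol a,\boldsymbol b\}$ the forms $E^{(2)}_{\boldsymbol x}(\tau)\,d\tau$, $\omega^+_{\boldsymbol x}$, $\omega^-_{\boldsymbol x}$ are admissible, the function $\log|g_{\boldsymbol x}|$ is admissible at $\infty$, and its regularised value $R_{\boldsymbol x}$ at $\infty$ is $\log|1-e(x_2)|$ if $x_1=0$, and $0$ if $x_1\ne0$. The form $\eta(g_{\boldsymbol a},g_{\boldsymbol b})$ is admissible, and $$\int_0^{\infty}\eta(g_{\boldsymbol a},g_{\boldsymbol b})=\operatorname{Im}\Lambda(\boldsymbol a,\boldsymbol b)-\Lambda^+(\boldsymbol a)\Lambda^-(\boldsymbol b)+R_{\boldsymbol a}\Lambda^-(\boldsymbol b)-R_{\boldsymbol b}\Lambda^-(\boldsymbol a).$$ If all coordinates of $\boldsymbol a$ and $\boldsymbol b$ are non-zero, this simplifies to $$\int_0^{\infty}\eta(g_{\boldsymbol a},g_{\boldsymbol b})=\operatorname{Im}\Lambda(\boldsymbol a,\boldsymbol b).$$ -/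

import Mathlib

open scoped ComplexConjugate ContDiff

namespace ModularRegulator

noncomputable section

/-! ### Regularised iterated integrals on the imaginary axis

A function on the imaginary axis `{i y : y > 0}` is written as a function `φ : ℝ → ℂ` of `y`, and a
differential form on it as `φ(y) dy`, with `φ : ℝ → ℂ` (so that `f(τ) dτ` is `φ(y) = f(i y) * i`).
Only the values at `y > 0` matter. Since `τ = i y`, polynomials in `τ` with complex coefficients are
the same functions as polynomials in `y` with complex coefficients, with the same constant term. -/

/-- `φ = P + (exponentially decaying)` at infinity. The polynomial `P` is unique. -/
def HasPolyPart (φ : ℝ → ℂ) (P : Polynomial ℂ) : Prop :=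
  ∃ c : ℝ, 0 < c ∧ c < 1 ∧
    Asymptotics.IsBigO Filter.atTop (fun y : ℝ => φ y - P.eval (y : ℂ)) (fun y : ℝ => c ^ y)

/-- Admissibility at infinity, of the function `φ` or of the form `φ(y) dy`. -/
def AdmissibleAtInfty (φ : ℝ → ℂ) : Prop :=
  ContDiffOn ℝ ∞ φ (Set.Ioi 0) ∧ ∃ P : Polynomial ℂ, HasPolyPart φ P

open Classical in
/-- The polynomial part at infinity, written with a superscript `∞` in the literature. -/
def polyPart (φ : ℝ → ℂ) : Polynomial ℂ :=
  if h : ∃ P : Polynomial ℂ, HasPolyPart φ P then h.choose else 0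

/-- The regularised value at infinity of a function: the constant term of its polynomial part. -/
def regValue (φ : ℝ → ℂ) : ℂ := (polyPart φ).coeff 0

/-- The pullback of the form `φ(y) dy` under `σ : τ ↦ -1/τ`, that is `y ↦ 1/y`. -/
def pullbackSigma (φ : ℝ → ℂ) : ℝ → ℂ := fun y => -φ (1 / y) / (y : ℂ) ^ 2

/-- Admissibility (at both `0` and `∞`) of the form `φ(y) dy`. -/
def AdmissibleForm (φ : ℝ → ℂ) : Prop :=
  AdmissibleAtInfty φ ∧ AdmissibleAtInfty (pullbackSigma φ)

/-- The ordinary iterated integral `∫_t^p ω₁ ⋯ ω_n = ∫_t^p ω₁(t₁) ∫_{t₁}^p ω₂(t₂) ⋯`. -/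
def iterInt (p : ℝ) : List (ℝ → ℂ) → ℝ → ℂ
  | [], _ => 1
  | φ :: l, t => ∫ s in t..p, φ s * iterInt p l s

/-- The regularised iterated integral `∫_t^∞ ω₁ ⋯ ω_n`, defined as the limit for `p → ∞` of
`∑_{k=0}^n ∫_t^p ω₁ ⋯ ω_k * ∫_p^0 ω_{k+1}^∞ ⋯ ω_n^∞`. -/
def regIterToInfty (l : List (ℝ → ℂ)) (t : ℝ) : ℂ :=
  Filter.limUnder Filter.atTop fun p : ℝ =>
    ∑ k ∈ Finset.range (l.length + 1),
      iterInt p (l.take k) t *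
        iterInt 0 ((l.drop k).map fun φ => fun y : ℝ => (polyPart φ).eval (y : ℂ)) p

/-- The regularised iterated integral
`∫_0^t ω₁ ⋯ ω_n = (-1)^n ∫_{σ t}^∞ σ^*ω_n ⋯ σ^*ω₁`. -/
def regIterFromZero (l : List (ℝ → ℂ)) (t : ℝ) : ℂ :=
  (-1) ^ l.length * regIterToInfty ((l.map pullbackSigma).reverse) (1 / t)

/-- The regularised iterated integral
`∫_0^∞ ω₁ ⋯ ω_n = ∑_{k=0}^n ∫_0^τ ω₁ ⋯ ω_k * ∫_τ^∞ ω_{k+1} ⋯ ω_n`, which does not depend on the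
choice of the intermediate point `τ` on the imaginary axis; we take `τ = i`. -/
def regIter (l : List (ℝ → ℂ)) : ℂ :=
  ∑ k ∈ Finset.range (l.length + 1),
    regIterFromZero (l.take k) 1 * regIterToInfty (l.drop k) 1

/-! ### Eisenstein series -/

/-- `A(L) = (conj ω₁ * ω₂ - ω₁ * conj ω₂) / (2 π i)` for `L = ℤ + τ ℤ`, `ω₁ = 1`, `ω₂ = τ`. -/
def latticeArea (τ : ℂ) : ℂ := (τ - conj τ) / (2 * Real.pi * Complex.I)

/-- The Kronecker double series over the lattice `ℤ + τ ℤ`, absolutely convergent for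
`Re s > 1 + a/2`. -/
def kroneckerSeries (a : ℕ) (x x₀ s τ : ℂ) : ℂ :=
  ∑' mn : ℤ × ℤ,
    let w : ℂ := mn.1 * τ + mn.2
    if w = -x then 0
    else Complex.exp ((latticeArea τ)⁻¹ * (w * conj x₀ - conj w * x₀)) *
      (conj w + conj x) ^ a / ((‖w + x‖ : ℝ) : ℂ) ^ (2 * s)

/-- `v` is the value at `s` of the analytic continuation of `z ↦ kroneckerSeries a x x₀ z τ`
from `Re z > 1 + a/2` to a half-plane containing `s`. There is at most one such `v`. -/
def IsKroneckerValue (a : ℕ) (x x₀ s τ v : ℂ) : Prop :=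
  ∃ r : ℝ, r < s.re ∧ ∃ F : ℂ → ℂ, DifferentiableOn ℂ F {z : ℂ | r < z.re} ∧
    (∀ z : ℂ, r < z.re → 1 + (a : ℝ) / 2 < z.re → F z = kroneckerSeries a x x₀ z τ) ∧ F s = v

open Classical in
/-- The analytically continued Kronecker double series `K_a(x, x₀, s; τ)`. -/
def kroneckerK (a : ℕ) (x x₀ s τ : ℂ) : ℂ :=
  if h : ∃ v : ℂ, IsKroneckerValue a x x₀ s τ v then h.choose else 0

/-- The Eisenstein series `E^{(k)}_x(τ) = -(k-1)!/(-2πi)^k * K_k(0, x₁ τ + x₂, k; τ)`. It depends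
only on the class of `x` modulo `ℤ²`. -/
def eisenstein (k : ℕ) (x : ℝ × ℝ) (τ : ℂ) : ℂ :=
  -(((k - 1).factorial : ℂ) / (-(2 * Real.pi * Complex.I)) ^ k) *
    kroneckerK k 0 (x.1 * τ + x.2) k τ

/-- The form `E^{(k)}_x(τ) dτ` on the imaginary axis. -/
def eisensteinForm (k : ℕ) (x : ℝ × ℝ) : ℝ → ℂ :=
  fun y => eisenstein k x (Complex.I * y) * Complex.I

/-- The multiple Eisenstein value
`Λ(x₁, …, x_n) = (2πi)^n ∫_0^∞ E^{(2)}_{x₁}(τ) dτ ⋯ E^{(2)}_{x_n}(τ) dτ`. -/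
def multipleEisensteinValue (l : List (ℝ × ℝ)) : ℂ :=
  (2 * Real.pi * Complex.I) ^ l.length * regIter (l.map (eisensteinForm 2))

/-! ### Siegel units -/

/-- `expTwoPiI z = e(z) = exp(2πiz)`. -/
def expTwoPiI (z : ℂ) : ℂ := Complex.exp (2 * Real.pi * Complex.I * z)

/-- The Siegel unit `g_x(τ)`, with `q^α = e(α τ)`. The real numbers `n ≥ 0`, `n ≡ x₁ mod 1` are
`{x₁} + j`, and the real numbers `n > 0`, `n ≡ -x₁ mod 1` are `1 - {x₁} + j`, with `j = 0, 1, …`;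
and `B₂(t) = t² - t + 1/6`. It depends only on the class of `x` modulo `ℤ²`. -/
def siegelUnit (x : ℝ × ℝ) (τ : ℂ) : ℂ :=
  expTwoPiI (((Int.fract x.1 ^ 2 - Int.fract x.1 + 1 / 6) / 2 : ℝ) * τ) *
    (∏' j : ℕ, (1 - expTwoPiI ((Int.fract x.1 + j : ℝ) * τ) * expTwoPiI x.2)) *
    (∏' j : ℕ, (1 - expTwoPiI ((1 - Int.fract x.1 + j : ℝ) * τ) * expTwoPiI (-x.2)))

/-- The function `log |g_x|` on the imaginary axis. -/
def logAbsSiegel (x : ℝ × ℝ) : ℝ → ℝ := fun y => Real.log ‖siegelUnit x (Complex.I * y)‖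

/-- `R_x`, the regularised value of `log |g_x|` at infinity. -/
def siegelReg (x : ℝ × ℝ) : ℂ := regValue fun y => (logAbsSiegel x y : ℂ)

/-- The form `dlog g_x = g_x'(τ)/g_x(τ) dτ` on the imaginary axis. -/
def dlogSiegel (x : ℝ × ℝ) : ℝ → ℂ :=
  fun y => logDeriv (siegelUnit x) (Complex.I * y) * Complex.I

/-- `ω_x^+ = Re (dlog g_x) = dlog |g_x|`. -/
def omegaPlus (x : ℝ × ℝ) : ℝ → ℂ := fun y => ((dlogSiegel x y).re : ℂ)

/-- `ω_x^- = Im (dlog g_x) = darg g_x`. -/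
def omegaMinus (x : ℝ × ℝ) : ℝ → ℂ := fun y => ((dlogSiegel x y).im : ℂ)

/-- `Λ^+(x) = ∫_0^∞ ω_x^+`. -/
def lambdaPlus (x : ℝ × ℝ) : ℂ := regIter [omegaPlus x]

/-- `Λ^-(x) = ∫_0^∞ ω_x^-`. -/
def lambdaMinus (x : ℝ × ℝ) : ℂ := regIter [omegaMinus x]

/-- `η(g_a, g_b) = log |g_a| darg g_b - log |g_b| darg g_a` on the imaginary axis. -/
def eta (a b : ℝ × ℝ) : ℝ → ℂ :=
  fun y => (logAbsSiegel a y : ℂ) * omegaMinus b y - (logAbsSiegel b y : ℂ) * omegaMinus a y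

/-- The point `(x₁/N, x₂/N)` attached to a pair of residue classes modulo `N`. -/
def torsionPoint {N : ℕ} (x : ZMod N × ZMod N) : ℝ × ℝ :=
  ((x.1.val : ℝ) / N, (x.2.val : ℝ) / N)

end

end ModularRegulator

open ModularRegulator

/-! # The regulator integral of two Siegel units as a double Eisenstein value

The proof separates the arithmetic of Siegel units from the analysis of regularised integrals.

*Analysis.* Call `θ(y) dy` a logarithmic form with logarithm `F` (`IsLogForm`) if `dF = Re θ`,
`θ = c + (exponentially small)` and `F = c y + R + (exponentially small)`. Suppose that `θ` and `υ`,
with logarithms `F` and `G`, are logarithmic at both cusps. Regularised integrals of length one and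
two from `t` to `∞` are then expressed by primitives: `F` with its constant `R` for `Re θ`, and the
primitive of `Im θ` that vanishes at `∞` (`HasTail.regIterToInfty_pair`). Taking the imaginary part
of the double integral of `θ` and `υ` and integrating by parts turns it into the integral of
`F Im υ - G Im θ`, up to boundary terms at `t = 1`; gluing the two cusps at that point gives
`IsLogForm.regIter_etaForm`, in which the constants at `∞` survive as the correction terms.

*Arithmetic.* The formula is applied to `θ = dlog g_x = 2πi E_x^{(2)} dτ` and `F = log |g_x|`. Three
facts are needed.
* `K_2(0, x₁ τ + x₂, s; τ)` continues analytically to `s = 2`, with value the iterated sum over rows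
  of `χ(w) / w²`, for a nontrivial character `χ` of the lattice. Choosing `v` with `χ(v) ≠ 1`, the
  series of differences `χ(w) (k(w) - k(w - v))` converges absolutely on a larger half-plane and is
  `1 - χ(v)` times the original series (`isKroneckerValue_two`). This also gives the behaviour under
  `τ ↦ -1/τ` (`IsKroneckerValue.inv`).
* Summing the rows by Lipschitz' formula, one finds the `q`-expansion of `E_x^{(2)}`
  (`eisenstein_two_eq`), which is the logarithmic derivative of the product for `g_x` up to `2πi`
  (`logDeriv_siegelUnit`). Hence `dlog g_x` is logarithmic at `∞`, and, since `σ` carries it to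
  `dlog g_{x'}` with `x' = (x₂, -x₁)`, also at `0`, with a logarithm that is known up to a constant.
* If both coordinates of `x` are non-integral then this constant is `0`: both `|g_x(i)|` and
  `|g_{x'}(i)|` are computed by the series `∑ χ(m, n) / (m² + n²)`, summed by rows and by columns
  (`logAbsSiegel_rotate_one`), and the two orders of summation agree by the same argument with
  differences (`tsum_tsum_comm_of_shift`). So `∫ dlog |g_x| = 0`, which is the simplified formula.
-/

namespace ModularRegulator

open Filter Set MeasureTheory Asymptotics Topology

/-! ### Exponentially decaying functions -/

/-- `f(y) = O(exp(-δ y))` as `y → ∞`, for some `δ > 0`. -/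
def ExpDecay (f : ℝ → ℂ) : Prop :=
  ∃ δ : ℝ, 0 < δ ∧ f =O[atTop] fun y : ℝ => Real.exp (-δ * y)

lemma isBigO_exp_neg_of_le {a b : ℝ} (h : a ≤ b) :
    (fun y : ℝ => Real.exp (-b * y)) =O[atTop] fun y : ℝ => Real.exp (-a * y) := by
  refine IsBigO.of_bound 1 ?_
  filter_upwards [eventually_ge_atTop 0] with y hy
  rw [one_mul, Real.norm_of_nonneg (Real.exp_pos _).le, Real.norm_of_nonneg (Real.exp_pos _).le]
  exact Real.exp_le_exp.2 (by nlinarith)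

namespace ExpDecay

variable {f g : ℝ → ℂ}

lemma add (hf : ExpDecay f) (hg : ExpDecay g) : ExpDecay fun y => f y + g y := by
  obtain ⟨a, ha, hf⟩ := hf
  obtain ⟨b, hb, hg⟩ := hg
  exact ⟨min a b, lt_min ha hb, (hf.trans (isBigO_exp_neg_of_le (min_le_left a b))).add
    (hg.trans (isBigO_exp_neg_of_le (min_le_right a b)))⟩

lemma const_mul (hf : ExpDecay f) (k : ℂ) : ExpDecay fun y => k * f y := by
  obtain ⟨a, ha, hf⟩ := hf
  exact ⟨a, ha, hf.const_mul_left k⟩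

lemma neg (hf : ExpDecay f) : ExpDecay fun y => -f y := by
  simpa using hf.const_mul (-1)

lemma sub (hf : ExpDecay f) (hg : ExpDecay g) : ExpDecay fun y => f y - g y := by
  simpa [sub_eq_add_neg] using hf.add hg.neg

lemma mul (hf : ExpDecay f) (hg : ExpDecay g) : ExpDecay fun y => f y * g y := by
  obtain ⟨a, ha, hf⟩ := hf
  obtain ⟨b, hb, hg⟩ := hg
  refine ⟨a + b, add_pos ha hb, (hf.mul hg).congr_right fun y => ?_⟩
  rw [← Real.exp_add]
  ring_nf

lemma id_mul (hf : ExpDecay f) : ExpDecay fun y => (y : ℂ) * f y := by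
  obtain ⟨a, ha, hf⟩ := hf
  refine ⟨a / 2, by positivity, ?_⟩
  have h1 : (fun y : ℝ => (y : ℂ)) =O[atTop] fun y : ℝ => Real.exp (a / 2 * y) := by
    refine IsBigO.trans ?_ (isLittleO_pow_exp_pos_mul_atTop 1 (half_pos ha)).isBigO
    exact IsBigO.of_bound 1 (by filter_upwards with y; simp)
  refine (h1.mul hf).congr_right fun y => ?_
  rw [← Real.exp_add]
  ring_nf

lemma congr' (hf : ExpDecay f) (h : ∀ y, 0 < y → f y = g y) : ExpDecay g := by
  obtain ⟨a, ha, hf⟩ := hf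
  refine ⟨a, ha, hf.congr' ?_ EventuallyEq.rfl⟩
  filter_upwards [eventually_gt_atTop 0] with y hy using h y hy

lemma of_norm_le (hf : ExpDecay f) (h : ∀ y, ‖g y‖ ≤ ‖f y‖) : ExpDecay g := by
  obtain ⟨a, ha, hf⟩ := hf
  exact ⟨a, ha, (IsBigO.of_bound 1 (by filter_upwards with y; simpa using h y)).trans hf⟩

lemma re (hf : ExpDecay f) : ExpDecay fun y => ((f y).re : ℂ) :=
  hf.of_norm_le fun y => by simpa using Complex.abs_re_le_norm (f y)

lemma im (hf : ExpDecay f) : ExpDecay fun y => ((f y).im : ℂ) :=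
  hf.of_norm_le fun y => by simpa using Complex.abs_im_le_norm (f y)

lemma tendsto (hf : ExpDecay f) : Tendsto f atTop (𝓝 0) := by
  obtain ⟨a, ha, hf⟩ := hf
  refine hf.trans_tendsto (Real.tendsto_exp_atBot.comp ?_)
  exact tendsto_id.const_mul_atTop_of_neg (neg_neg_of_pos ha)

lemma integrableOn (hf : ExpDecay f) {t : ℝ} (hc : ContinuousOn f (Ioi 0)) (ht : 0 < t) :
    IntegrableOn f (Ioi t) := by
  obtain ⟨a, ha, hf⟩ := hf
  have hc' : ContinuousOn f (Ici t) := hc.mono fun s hs => ht.trans_le hs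
  refine integrableOn_Ici_iff_integrableOn_Ioi (by finiteness) |>.mp <|
    (hc'.locallyIntegrableOn measurableSet_Ici).integrableOn_of_isBigO_atTop
    hf ⟨Ioi a, Ioi_mem_atTop a, exp_neg_integrableOn_Ioi a ha⟩

lemma integral_Ioi (hf : ExpDecay f) (hc : ContinuousOn f (Ioi 0)) :
    ExpDecay fun y => ∫ s in Ioi y, f s := by
  have hfi := hf.integrableOn hc one_pos
  obtain ⟨a, ha, hf⟩ := hf
  refine ⟨a, ha, ?_⟩
  obtain ⟨C, hC⟩ := hf.bound
  obtain ⟨y₀, hy₀⟩ := eventually_atTop.1 hC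
  refine IsBigO.of_bound (C / a) ?_
  filter_upwards [eventually_ge_atTop y₀, eventually_ge_atTop 1] with y hy hy1
  have hexp : IntegrableOn (fun s => Real.exp (-a * s)) (Ioi y) := exp_neg_integrableOn_Ioi y ha
  calc ‖∫ s in Ioi y, f s‖ ≤ ∫ s in Ioi y, ‖f s‖ := norm_integral_le_integral_norm _
    _ ≤ ∫ s in Ioi y, C * Real.exp (-a * s) := by
        refine setIntegral_mono_on ?_ (hexp.const_mul C) measurableSet_Ioi fun s hs => ?_
        · exact (hfi.mono_set (Ioi_subset_Ioi hy1)).norm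
        · simpa using hy₀ s (hy.trans (le_of_lt hs))
    _ = C / a * ‖Real.exp (-a * y)‖ := by
        rw [integral_const_mul, integral_exp_mul_Ioi (neg_neg_of_pos ha),
          Real.norm_of_nonneg (Real.exp_pos _).le]
        field_simp

end ExpDecay

lemma hasPolyPart_iff {φ : ℝ → ℂ} {P : Polynomial ℂ} :
    HasPolyPart φ P ↔ ExpDecay fun y => φ y - P.eval (y : ℂ) := by
  constructor
  · rintro ⟨c, hc0, hc1, h⟩
    refine ⟨-Real.log c, by simpa using Real.log_neg hc0 hc1, h.congr_right fun y => ?_⟩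
    rw [Real.rpow_def_of_pos hc0, neg_neg]
  · rintro ⟨δ, hδ, h⟩
    refine ⟨Real.exp (-δ), Real.exp_pos _, by simpa using hδ, h.congr_right fun y => ?_⟩
    rw [Real.exp_mul]

lemma polyPart_eq {φ : ℝ → ℂ} {P : Polynomial ℂ} (h : HasPolyPart φ P) : polyPart φ = P := by
  have hex : ∃ P : Polynomial ℂ, HasPolyPart φ P := ⟨P, h⟩
  have h2 : HasPolyPart φ (polyPart φ) := by
    rw [polyPart, dif_pos hex]
    exact hex.choose_spec
  rw [hasPolyPart_iff] at h h2
  have h3 := (h.sub h2).tendsto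
  have h4 : Tendsto (fun y : ℝ => (polyPart φ - P).eval (y : ℂ)) atTop (𝓝 0) := by
    refine h3.congr fun y => ?_
    rw [Polynomial.eval_sub]
    ring
  rw [← sub_eq_zero]
  by_cases hdeg : 0 < (polyPart φ - P).degree
  · have h5 := Polynomial.tendsto_norm_atTop (polyPart φ - P) hdeg
      (z := fun y : ℝ => (y : ℂ)) (l := atTop)
      (by simpa using tendsto_abs_atTop_atTop)
    exact absurd h4.norm (by simpa using not_tendsto_nhds_of_tendsto_atTop h5 0)
  · rw [not_lt] at hdeg
    rw [Polynomial.eq_C_of_degree_le_zero hdeg] at h4 ⊢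
    simp only [Polynomial.eval_C] at h4
    rw [tendsto_nhds_unique tendsto_const_nhds h4, Polynomial.C_0]

lemma AdmissibleAtInfty.of_expDecay {φ : ℝ → ℂ} (hs : ContDiffOn ℝ ∞ φ (Ioi 0))
    (P : Polynomial ℂ) (h : ExpDecay fun y => φ y - P.eval (y : ℂ)) : AdmissibleAtInfty φ :=
  ⟨hs, P, hasPolyPart_iff.2 h⟩

/-! ### Regularised integrals of forms with constant polynomial part -/

/-- The form `φ(y) dy` is `k (c + β(y)) dy` for `y > 0`, where `β` is continuous, decays
exponentially at infinity, and has the exponentially decaying primitive `B`. The factor `k` is kept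
apart in order that `c` can be real for `φ dy = E dτ = (2πi)⁻¹ dlog g`. -/
structure HasTail (φ : ℝ → ℂ) (k c : ℂ) (β B : ℝ → ℂ) : Prop where
  eq : ∀ y, 0 < y → φ y = k * (c + β y)
  cont : ContinuousOn β (Ioi 0)
  decay : ExpDecay β
  deriv : ∀ y, 0 < y → HasDerivAt B (β y) y
  decay_primitive : ExpDecay B

namespace HasTail

variable {φ ψ β B α A : ℝ → ℂ} {k c d : ℂ}

lemma polyPart (h : HasTail φ k c β B) : polyPart φ = Polynomial.C (k * c) := by
  refine polyPart_eq (hasPolyPart_iff.2 ((h.decay.const_mul k).congr' fun y hy => ?_))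
  rw [h.eq y hy, Polynomial.eval_C]
  ring

lemma cont_primitive (h : HasTail φ k c β B) : ContinuousOn B (Ioi 0) := fun y hy =>
  (h.deriv y hy).continuousAt.continuousWithinAt

lemma integral (h : HasTail φ k c β B) {t p : ℝ} (ht : 0 < t) (hp : 0 < p) :
    ∫ s in t..p, φ s = k * (c * (p - t) + B p - B t) := by
  have hpos : ∀ s ∈ uIcc t p, 0 < s := fun s hs => (lt_min ht hp).trans_le hs.1
  have hder : ∀ s ∈ uIcc t p, HasDerivAt (fun s : ℝ => k * (c * s + B s)) (φ s) s := by
    intro s hs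
    rw [h.eq s (hpos s hs)]
    have h1 : HasDerivAt (fun s : ℝ => (s : ℂ)) 1 s := Complex.ofRealCLM.hasDerivAt
    simpa using ((h1.const_mul c).add (h.deriv s (hpos s hs))).const_mul k
  rw [intervalIntegral.integral_eq_sub_of_hasDerivAt hder]
  · ring
  · refine ContinuousOn.intervalIntegrable ?_
    have h2 : ContinuousOn (fun s => k * (c + β s)) (uIcc t p) :=
      continuousOn_const.mul (continuousOn_const.add (h.cont.mono hpos))
    exact h2.congr fun s hs => h.eq s (hpos s hs)

lemma regIterToInfty_singleton (h : HasTail φ k c β B) {t : ℝ} (ht : 0 < t) :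
    regIterToInfty [φ] t = -(k * (c * t + B t)) := by
  refine Tendsto.limUnder_eq ?_
  have hlim : Tendsto (fun p => k * B p - k * (c * t + B t)) atTop
      (𝓝 (k * 0 - k * (c * t + B t))) :=
    (h.decay_primitive.tendsto.const_mul k).sub_const _
  rw [mul_zero, zero_sub] at hlim
  refine hlim.congr' ?_
  filter_upwards [eventually_gt_atTop 0] with p hp
  simp only [List.length_singleton, Finset.sum_range_succ, Finset.sum_range_zero, List.take_zero,
    List.drop_zero, List.map_cons, List.map_nil, iterInt, h.polyPart, Polynomial.eval_C,
    List.take_succ_cons, List.drop_succ_cons, List.drop_nil, mul_one, one_mul, zero_add]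
  rw [h.integral ht hp, intervalIntegral.integral_const]
  simp only [zero_sub, Complex.real_smul, Complex.ofReal_neg]
  ring

/-- With `φ = k (c + α)` and `ψ = k (d + β)`, the divergent terms `c d p² / 2`, `c d p t` and
`d p ∫ α` of the three summands in the definition of `∫_t^∞ φ ψ` cancel. -/
lemma regIterToInfty_pair (h : HasTail φ k c α A) (h' : HasTail ψ k d β B) {t : ℝ} (ht : 0 < t) :
    regIterToInfty [φ, ψ] t =
      k ^ 2 * (c * d * t ^ 2 / 2 -
        ∫ s in Ioi t, (c * B s + d * (s * α s) + α s * B s)) := by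
  refine Tendsto.limUnder_eq ?_
  set γ : ℝ → ℂ := fun s => c * B s + d * (s * α s) + α s * B s with hγ
  have hγd : ExpDecay γ :=
    ((h'.decay_primitive.const_mul c).add (h.decay.id_mul.const_mul d)).add
      (h.decay.mul h'.decay_primitive)
  have hγc : ContinuousOn γ (Ioi 0) := by
    have h1 := h.cont
    have h2 := h'.cont_primitive
    have h3 : Continuous fun s : ℝ => (s : ℂ) := Complex.continuous_ofReal
    fun_prop
  have hlim : Tendsto (fun p : ℝ => k ^ 2 * (c * d * t ^ 2 / 2 + c * (p * B p - t * B p)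
      + B p * (A p - A t) - ∫ s in t..p, γ s)) atTop
      (𝓝 (k ^ 2 * (c * d * t ^ 2 / 2 + c * (0 - t * 0) + 0 * (0 - A t) - ∫ s in Ioi t, γ s))) := by
    have hB := h'.decay_primitive.tendsto
    have hpB := h'.decay_primitive.id_mul.tendsto
    have hA := h.decay_primitive.tendsto
    have hi := intervalIntegral_tendsto_integral_Ioi t (hγd.integrableOn hγc ht) tendsto_id
    exact ((((hpB.sub (hB.const_mul _)).const_mul c).const_add _).add
      (hB.mul (hA.sub_const _)) |>.sub hi).const_mul _
  simp only [mul_zero, sub_zero, add_zero, zero_mul] at hlim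
  refine hlim.congr' ?_
  filter_upwards [eventually_gt_atTop 0] with p hp
  have hpos : ∀ s ∈ uIcc t p, 0 < s := fun s hs => (lt_min ht hp).trans_le hs.1
  simp only [List.length_cons, List.length_nil, Finset.sum_range_succ, Finset.sum_range_zero,
    List.take_zero, zero_add,
    List.drop_zero, List.map_cons, List.map_nil, iterInt, h.polyPart, h'.polyPart,
    Polynomial.eval_C,
    List.take_succ_cons, List.drop_succ_cons, List.drop_nil, mul_one, one_mul]
  have hin : ∫ s in t..p, φ s * ∫ s' in s..p, ψ s' = ∫ s in t..p, k ^ 2 *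
      (c * d * p + c * B p - c * d * s + (d * p + B p) * α s - γ s) := by
    refine intervalIntegral.integral_congr fun s hs => ?_
    simp only [h'.integral (hpos s hs) hp, h.eq s (hpos s hs), hγ]
    ring
  have hα : IntervalIntegrable α volume t p := (h.cont.mono hpos).intervalIntegrable
  have hγi : IntervalIntegrable γ volume t p := (hγc.mono hpos).intervalIntegrable
  have hid : IntervalIntegrable (fun s : ℝ => (s : ℂ)) volume t p :=
    Complex.continuous_ofReal.intervalIntegrable _ _
  have hαint : ∫ s in t..p, α s = A p - A t :=
    intervalIntegral.integral_eq_sub_of_hasDerivAt (fun s hs => h.deriv s (hpos s hs)) hα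
  have hc0 : ∀ z : ℂ, IntervalIntegrable (fun _ : ℝ => z) volume t p :=
    fun z => intervalIntegrable_const
  have hout : ∫ s in p..(0 : ℝ), k * c * ∫ _ in s..(0 : ℝ), k * d = k ^ 2 * (c * d) * p ^ 2 / 2 := by
    simp only [intervalIntegral.integral_const, zero_sub, Complex.real_smul, Complex.ofReal_neg]
    rw [intervalIntegral.integral_congr (g := fun s : ℝ => -(k ^ 2 * (c * d)) * (s : ℂ))
      (fun s _ => by ring), intervalIntegral.integral_const_mul, intervalIntegral.integral_ofReal,
      integral_id]
    push_cast
    ring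
  rw [hin, hout, h.integral ht hp, intervalIntegral.integral_const_mul (k ^ 2),
    intervalIntegral.integral_sub (((hc0 _).sub (hid.const_mul _)).add (hα.const_mul _)) hγi,
    intervalIntegral.integral_add ((hc0 _).sub (hid.const_mul _)) (hα.const_mul _),
    intervalIntegral.integral_sub (hc0 _) (hid.const_mul _),
    intervalIntegral.integral_const_mul (c * d), intervalIntegral.integral_const_mul (d * p + B p),
    intervalIntegral.integral_const,
    intervalIntegral.integral_const, intervalIntegral.integral_ofReal, integral_id, hαint]
  simp only [Complex.real_smul]
  push_cast
  ring

end HasTail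

lemma regIterToInfty_nil (t : ℝ) : regIterToInfty [] t = 1 := by
  refine Tendsto.limUnder_eq ?_
  simp [iterInt]

lemma regIter_singleton {φ β B β' B' : ℝ → ℂ} {k c k' c' : ℂ} (h : HasTail φ k c β B)
    (h' : HasTail (pullbackSigma φ) k' c' β' B') :
    regIter [φ] = k' * (c' + B' 1) - k * (c + B 1) := by
  simp only [regIter, List.length_singleton, Finset.sum_range_succ, Finset.sum_range_zero,
    List.take_zero, List.drop_zero, List.take_succ_cons, List.drop_succ_cons, List.drop_nil,
    regIterFromZero, List.length_nil, List.map_nil, List.reverse_nil, List.map_cons,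
    List.reverse_singleton, regIterToInfty_nil, h.regIterToInfty_singleton one_pos, div_one,
    h'.regIterToInfty_singleton one_pos]
  push_cast
  ring

lemma regIter_pair (φ ψ : ℝ → ℂ) :
    regIter [φ, ψ] = regIterToInfty [φ, ψ] 1
      - regIterToInfty [pullbackSigma φ] 1 * regIterToInfty [ψ] 1
      + regIterToInfty [pullbackSigma ψ, pullbackSigma φ] 1 := by
  simp only [regIter, List.length_cons, List.length_nil, Finset.sum_range_succ,
    Finset.sum_range_zero, List.take_zero, List.drop_zero, List.take_succ_cons,
    List.drop_succ_cons, List.drop_nil, regIterFromZero, List.map_nil, List.reverse_nil,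
    List.map_cons, List.reverse_cons, List.nil_append, List.cons_append, regIterToInfty_nil,
    div_one]
  ring

/-! ### Logarithmic forms and their iterated integrals -/

lemma ExpDecay.hasDerivAt_integral_Ioi {f : ℝ → ℂ} (hf : ExpDecay f) (hc : ContinuousOn f (Ioi 0))
    {y : ℝ} (hy : 0 < y) : HasDerivAt (fun y => -∫ s in Ioi y, f s) (f y) y := by
  have hy2 : 0 < y / 2 := half_pos hy
  have hint : ∀ t, 0 < t → IntegrableOn f (Ioi t) := fun t ht => hf.integrableOn hc ht
  have h1 : HasDerivAt (fun u => (∫ s in (y / 2)..u, f s) - ∫ s in Ioi (y / 2), f s) (f y) y := by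
    refine (intervalIntegral.integral_hasDerivAt_right ?_ ?_ ?_).sub_const _
    · refine (hc.mono fun s hs => ?_).intervalIntegrable
      exact (lt_min hy2 hy).trans_le hs.1
    · exact hc.stronglyMeasurableAtFilter isOpen_Ioi y hy
    · exact hc.continuousAt (Ioi_mem_nhds hy)
  refine h1.congr_of_eventuallyEq ?_
  filter_upwards [Ioi_mem_nhds hy] with u hu
  rw [← intervalIntegral.integral_Ioi_sub_Ioi' (hint _ hy2) (hint _ hu)]
  ring

/-- `θ(y) dy` has real part `dF`, with `θ = c` and `F = c y + R` up to exponentially decaying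
functions. The model is `θ = dlog g`, `F = log |g|`. -/
structure IsLogForm (θ : ℝ → ℂ) (F : ℝ → ℝ) (c R : ℝ) : Prop where
  cont : ContinuousOn θ (Ioi 0)
  deriv : ∀ y, 0 < y → HasDerivAt F (θ y).re y
  decay : ExpDecay fun y => θ y - c
  decay_log : ExpDecay fun y => (F y : ℂ) - (c * y + R)

/-- The primitive of `Im θ` that vanishes at infinity. -/
noncomputable def argPrimitive (θ : ℝ → ℂ) (y : ℝ) : ℝ := -∫ s in Ioi y, (θ s).im

/-- `η = F darg - G darg`, for two logarithmic forms. -/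
noncomputable def etaForm (θ υ : ℝ → ℂ) (F G : ℝ → ℝ) : ℝ → ℂ :=
  fun y => (F y : ℂ) * ((υ y).im : ℂ) - (G y : ℂ) * ((θ y).im : ℂ)

namespace IsLogForm

variable {θ υ : ℝ → ℂ} {F G : ℝ → ℝ} {c d R S : ℝ}

lemma decay_im (h : IsLogForm θ F c R) : ExpDecay fun y => ((θ y).im : ℂ) := by
  simpa using h.decay.im

lemma cont_im (h : IsLogForm θ F c R) : ContinuousOn (fun y => ((θ y).im : ℂ)) (Ioi 0) :=
  (Complex.continuous_ofReal.comp Complex.continuous_im).comp_continuousOn h.cont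

lemma cont_log (h : IsLogForm θ F c R) : ContinuousOn F (Ioi 0) := fun y hy =>
  (h.deriv y hy).continuousAt.continuousWithinAt

lemma ofReal_argPrimitive (θ : ℝ → ℂ) (y : ℝ) :
    (argPrimitive θ y : ℂ) = -∫ s in Ioi y, ((θ s).im : ℂ) := by
  rw [argPrimitive, integral_complex_ofReal, Complex.ofReal_neg]

lemma decay_arg (h : IsLogForm θ F c R) : ExpDecay fun y => (argPrimitive θ y : ℂ) := by
  simp only [ofReal_argPrimitive]
  exact (h.decay_im.integral_Ioi h.cont_im).neg

lemma hasDerivAt_arg (h : IsLogForm θ F c R) {y : ℝ} (hy : 0 < y) :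
    HasDerivAt (fun y => (argPrimitive θ y : ℂ)) ((θ y).im : ℂ) y := by
  simp only [ofReal_argPrimitive]
  exact h.decay_im.hasDerivAt_integral_Ioi h.cont_im hy

lemma hasTail_im (h : IsLogForm θ F c R) :
    HasTail (fun y => ((θ y).im : ℂ)) 1 0 (fun y => ((θ y).im : ℂ))
      fun y => (argPrimitive θ y : ℂ) where
  eq y _ := by simp
  cont := h.cont_im
  decay := h.decay_im
  deriv _ hy := h.hasDerivAt_arg hy
  decay_primitive := h.decay_arg

lemma hasTail_re (h : IsLogForm θ F c R) :
    HasTail (fun y => ((θ y).re : ℂ)) 1 c (fun y => ((θ y).re : ℂ) - c)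
      fun y => (F y : ℂ) - (c * y + R) where
  eq y _ := by ring
  cont := ((Complex.continuous_ofReal.comp Complex.continuous_re).comp_continuousOn h.cont).sub
    continuousOn_const
  decay := by simpa using h.decay.re
  deriv y hy := by
    have h1 : HasDerivAt (fun s : ℝ => (s : ℂ)) 1 y := Complex.ofRealCLM.hasDerivAt
    have h2 := (h.deriv y hy).ofReal_comp.sub ((h1.const_mul (c : ℂ)).add_const (R : ℂ))
    rwa [mul_one] at h2
  decay_primitive := h.decay_log

lemma hasTail (h : IsLogForm θ F c R) {φ : ℝ → ℂ} {k : ℂ} (hφ : ∀ y, 0 < y → φ y = k * θ y) :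
    HasTail φ k c (fun y => θ y - c)
      fun y => (F y : ℂ) - (c * y + R) + Complex.I * argPrimitive θ y where
  eq y hy := by rw [hφ y hy]; ring
  cont := h.cont.sub continuousOn_const
  decay := h.decay
  deriv y hy := by
    have h1 := (h.hasTail_re.deriv y hy).add ((h.hasDerivAt_arg hy).const_mul Complex.I)
    have h2 : ((θ y).re : ℂ) - c + Complex.I * ((θ y).im : ℂ) = θ y - c := by
      linear_combination Complex.re_add_im (θ y)
    rwa [h2] at h1
  decay_primitive := h.decay_log.add (h.decay_arg.const_mul _)

lemma cont_eta (h : IsLogForm θ F c R) (h' : IsLogForm υ G d S) :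
    ContinuousOn (etaForm θ υ F G) (Ioi 0) :=
  ((Complex.continuous_ofReal.comp_continuousOn h.cont_log).mul h'.cont_im).sub
    ((Complex.continuous_ofReal.comp_continuousOn h'.cont_log).mul h.cont_im)

lemma decay_log_mul (h : IsLogForm θ F c R) {f : ℝ → ℂ} (hf : ExpDecay f) :
    ExpDecay fun y => (F y : ℂ) * f y := by
  refine (((h.decay_log.mul hf).add (hf.id_mul.const_mul c)).add (hf.const_mul R)).congr'
    fun y _ => ?_
  ring

lemma decay_eta (h : IsLogForm θ F c R) (h' : IsLogForm υ G d S) :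
    ExpDecay (etaForm θ υ F G) :=
  (h.decay_log_mul h'.decay_im).sub (h'.decay_log_mul h.decay_im)

lemma hasTail_eta (h : IsLogForm θ F c R) (h' : IsLogForm υ G d S) :
    HasTail (etaForm θ υ F G) 1 0 (etaForm θ υ F G)
      fun y => -∫ s in Ioi y, etaForm θ υ F G s where
  eq y _ := by simp
  cont := h.cont_eta h'
  decay := h.decay_eta h'
  deriv _ hy := (h.decay_eta h').hasDerivAt_integral_Ioi (h.cont_eta h') hy
  decay_primitive := ((h.decay_eta h').integral_Ioi (h.cont_eta h')).neg

/-- The imaginary part of `∫_t^∞ θ υ`. Writing `A` and `B` for the primitives of `Im θ` and `Im υ`,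
normalised to vanish at infinity, the function `F B - S A + ∫_s^∞ η` decays at infinity, and its
derivative is the imaginary part of the integrand in `HasTail.regIterToInfty_pair`. -/
lemma im_regIterToInfty_pair (h : IsLogForm θ F c R) (h' : IsLogForm υ G d S) {φ ψ : ℝ → ℂ}
    {k κ : ℂ} (hκ : κ * k = 1) (hφ : ∀ y, 0 < y → φ y = k * θ y)
    (hψ : ∀ y, 0 < y → ψ y = k * υ y) {t : ℝ} (ht : 0 < t) :
    ((κ ^ 2 * regIterToInfty [φ, ψ] t).im : ℂ) =
      (∫ s in Ioi t, etaForm θ υ F G s) + F t * argPrimitive υ t - S * argPrimitive θ t := by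
  have hT := h.hasTail hφ
  have hT' := h'.hasTail hψ
  rw [hT.regIterToInfty_pair hT' ht, ← mul_assoc, ← mul_pow, hκ, one_pow, one_mul]
  set γ : ℝ → ℂ := fun s => c * ((G s : ℂ) - (d * s + S) + Complex.I * argPrimitive υ s)
    + d * (s * (θ s - c))
    + (θ s - c) * ((G s : ℂ) - (d * s + S) + Complex.I * argPrimitive υ s) with hγ
  have hγd : ExpDecay γ :=
    ((hT'.decay_primitive.const_mul c).add (hT.decay.id_mul.const_mul d)).add
      (hT.decay.mul hT'.decay_primitive)
  have hγc : ContinuousOn γ (Ioi 0) := by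
    have h1 := hT.cont
    have h2 := hT'.cont_primitive
    have h3 : Continuous fun s : ℝ => (s : ℂ) := Complex.continuous_ofReal
    simp only [hγ]
    exact ((continuousOn_const.mul h2).add (continuousOn_const.mul
      (h3.continuousOn.mul h1))).add (h1.mul h2)
  have hγi := hγd.integrableOn hγc ht
  have him : ((∫ s in Ioi t, γ s).im : ℂ) = ∫ s in Ioi t, ((γ s).im : ℂ) := by
    rw [integral_complex_ofReal]
    exact congrArg _ (Complex.imCLM.integral_comp_comm hγi).symm
  have hγim : ∀ s, ((γ s).im : ℂ) =
      ((θ s).re : ℂ) * argPrimitive υ s + F s * ((υ s).im : ℂ) - S * ((θ s).im : ℂ)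
        - etaForm θ υ F G s := by
    intro s
    rw [etaForm, ← Complex.ofReal_mul, ← Complex.ofReal_mul, ← Complex.ofReal_mul,
      ← Complex.ofReal_mul, ← Complex.ofReal_add, ← Complex.ofReal_sub, ← Complex.ofReal_sub,
      ← Complex.ofReal_sub]
    congr 1
    simp [hγ]
    ring
  have hprim : ∫ s in Ioi t, ((γ s).im : ℂ) = 0 - ((F t : ℂ) * argPrimitive υ t
      - S * argPrimitive θ t - -∫ s in Ioi t, etaForm θ υ F G s) := by
    refine integral_Ioi_of_hasDerivAt_of_tendsto' (f := fun t => (F t : ℂ) * argPrimitive υ t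
      - S * argPrimitive θ t - -∫ s in Ioi t, etaForm θ υ F G s) (fun s hs => ?_) ?_ ?_
    · have hs0 : 0 < s := ht.trans_le hs
      rw [hγim]
      exact (((h.deriv s hs0).ofReal_comp.mul (h'.hasDerivAt_arg hs0)).sub
        ((h.hasDerivAt_arg hs0).const_mul _)).sub ((h.hasTail_eta h').deriv s hs0)
    · exact (Complex.ofRealCLM.comp Complex.imCLM).integrable_comp hγi
    · exact (((h.decay_log_mul h'.decay_arg).sub (h.decay_arg.const_mul _)).sub
        (h.hasTail_eta h').decay_primitive).tendsto
  have hreal : ((c : ℂ) * d * t ^ 2 / 2).im = 0 := by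
    rw [show (c : ℂ) * d * t ^ 2 / 2 = ((c * d * t ^ 2 / 2 : ℝ) : ℂ) by push_cast; ring,
      Complex.ofReal_im]
  rw [Complex.sub_im, hreal, Complex.ofReal_sub, him, hprim]
  push_cast
  ring

end IsLogForm

lemma pullbackSigma_ofReal_re (θ : ℝ → ℂ) :
    pullbackSigma (fun y => ((θ y).re : ℂ)) = fun y => ((pullbackSigma θ y).re : ℂ) := by
  funext y
  simp only [pullbackSigma]
  rw [← Complex.ofReal_pow, Complex.div_ofReal_re]
  push_cast
  simp

lemma pullbackSigma_ofReal_im (θ : ℝ → ℂ) :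
    pullbackSigma (fun y => ((θ y).im : ℂ)) = fun y => ((pullbackSigma θ y).im : ℂ) := by
  funext y
  simp only [pullbackSigma]
  rw [← Complex.ofReal_pow, Complex.div_ofReal_im]
  push_cast
  simp

lemma pullbackSigma_etaForm (θ υ : ℝ → ℂ) (F G : ℝ → ℝ) :
    pullbackSigma (etaForm θ υ F G) =
      etaForm (pullbackSigma θ) (pullbackSigma υ) (fun y => F (1 / y)) fun y => G (1 / y) := by
  funext y
  simp only [etaForm]
  have h1 := congrFun (pullbackSigma_ofReal_im θ) y
  have h2 := congrFun (pullbackSigma_ofReal_im υ) y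
  rw [← h1, ← h2]
  simp only [pullbackSigma, etaForm]
  ring

section Regulator

variable {θ υ : ℝ → ℂ} {F G : ℝ → ℝ} {c c' d d' R R' S S' : ℝ}

lemma IsLogForm.regIter_re (h : IsLogForm θ F c R)
    (h' : IsLogForm (pullbackSigma θ) (fun y => F (1 / y)) c' R') :
    regIter [fun y => ((θ y).re : ℂ)] = R - R' := by
  have h2 := h'.hasTail_re
  rw [← pullbackSigma_ofReal_re] at h2
  rw [regIter_singleton h.hasTail_re h2]
  norm_num
  ring

lemma IsLogForm.regIter_im (h : IsLogForm θ F c R)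
    (h' : IsLogForm (pullbackSigma θ) (fun y => F (1 / y)) c' R') :
    regIter [fun y => ((θ y).im : ℂ)] = argPrimitive (pullbackSigma θ) 1 - argPrimitive θ 1 := by
  have h2 := h'.hasTail_im
  rw [← pullbackSigma_ofReal_im] at h2
  rw [regIter_singleton h.hasTail_im h2]
  ring

/-- The regulator integral of two logarithmic forms, as the imaginary part of a length two
iterated integral and products of length one integrals. -/
theorem IsLogForm.regIter_etaForm (ha : IsLogForm θ F c R)
    (ha' : IsLogForm (pullbackSigma θ) (fun y => F (1 / y)) c' R')
    (hb : IsLogForm υ G d S)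
    (hb' : IsLogForm (pullbackSigma υ) (fun y => G (1 / y)) d' S')
    {φ ψ : ℝ → ℂ} {k κ : ℂ} (hκ : κ * k = 1) (hφ : ∀ y, 0 < y → φ y = k * θ y)
    (hψ : ∀ y, 0 < y → ψ y = k * υ y) :
    regIter [etaForm θ υ F G] = ((κ ^ 2 * regIter [φ, ψ]).im : ℂ)
      - regIter [fun y => ((θ y).re : ℂ)] * regIter [fun y => ((υ y).im : ℂ)]
      + R * regIter [fun y => ((υ y).im : ℂ)] - S * regIter [fun y => ((θ y).im : ℂ)] := by
  have hφ' : ∀ y, 0 < y → pullbackSigma φ y = k * pullbackSigma θ y := by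
    intro y hy
    simp only [pullbackSigma]
    rw [hφ _ (by positivity)]
    ring
  have hψ' : ∀ y, 0 < y → pullbackSigma ψ y = k * pullbackSigma υ y := by
    intro y hy
    simp only [pullbackSigma]
    rw [hψ _ (by positivity)]
    ring
  have h2 := ha'.hasTail_eta hb'
  rw [← pullbackSigma_etaForm] at h2
  -- `σ` reverses the order of the two forms, and `η` is antisymmetric
  have hanti : etaForm (pullbackSigma υ) (pullbackSigma θ) (fun y => G (1 / y))
      (fun y => F (1 / y)) = fun y => -pullbackSigma (etaForm θ υ F G) y := by
    rw [pullbackSigma_etaForm]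
    funext y
    simp only [etaForm]
    ring
  have e1 := ha.im_regIterToInfty_pair hb hκ hφ hψ one_pos
  have e2 := hb'.im_regIterToInfty_pair ha' hκ hψ' hφ' one_pos
  rw [hanti, integral_neg, div_one] at e2
  have e3 : ((κ ^ 2 * (regIterToInfty [pullbackSigma φ] 1 * regIterToInfty [ψ] 1)).im : ℂ) =
      -((R' - F 1) * argPrimitive υ 1 + argPrimitive (pullbackSigma θ) 1 * (S - G 1)) := by
    rw [(ha'.hasTail hφ').regIterToInfty_singleton one_pos,
      (hb.hasTail hψ).regIterToInfty_singleton one_pos]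
    rw [show ∀ x y : ℂ, κ ^ 2 * (-(k * x) * -(k * y)) = (κ * k) ^ 2 * (x * y) by
      intro x y; ring, hκ, one_pow, one_mul]
    norm_cast
    simp
    ring
  rw [ha.regIter_re ha', ha.regIter_im ha', hb.regIter_im hb', regIter_singleton
    (ha.hasTail_eta hb) h2, regIter_pair, mul_add (κ ^ 2), mul_sub (κ ^ 2), Complex.add_im,
    Complex.sub_im, Complex.ofReal_add, Complex.ofReal_sub, e1, e2, e3]
  ring

end Regulator

/-! ### Fourier expansions -/

lemma expTwoPiI_add (z w : ℂ) : expTwoPiI (z + w) = expTwoPiI z * expTwoPiI w := by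
  simp only [expTwoPiI, mul_add, Complex.exp_add]

lemma expTwoPiI_zero : expTwoPiI 0 = 1 := by simp [expTwoPiI]

lemma expTwoPiI_int (n : ℤ) : expTwoPiI n = 1 := by
  rw [expTwoPiI, Complex.exp_eq_one_iff]
  exact ⟨n, by ring⟩

lemma expTwoPiI_nat_mul (n : ℕ) (z : ℂ) : expTwoPiI (n * z) = expTwoPiI z ^ n := by
  rw [expTwoPiI, expTwoPiI, ← Complex.exp_nat_mul]
  ring_nf

lemma expTwoPiI_neg (z : ℂ) : expTwoPiI (-z) = (expTwoPiI z)⁻¹ := by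
  rw [expTwoPiI, expTwoPiI, ← Complex.exp_neg]
  ring_nf

lemma norm_expTwoPiI (z : ℂ) : ‖expTwoPiI z‖ = Real.exp (-(2 * Real.pi * z.im)) := by
  rw [expTwoPiI, Complex.norm_exp]
  simp

lemma norm_expTwoPiI_ofReal (t : ℝ) : ‖expTwoPiI t‖ = 1 := by
  simp [norm_expTwoPiI]

lemma norm_expTwoPiI_lt_one {z : ℂ} (hz : 0 < z.im) : ‖expTwoPiI z‖ < 1 := by
  rw [norm_expTwoPiI, Real.exp_lt_one_iff, neg_lt_zero]
  positivity

lemma expTwoPiI_ofReal_eq_one_iff (t : ℝ) : expTwoPiI t = 1 ↔ Int.fract t = 0 := by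
  rw [expTwoPiI, Complex.exp_eq_one_iff, Int.fract_eq_zero_iff]
  have h : (2 * Real.pi * Complex.I : ℂ) ≠ 0 := by simp [Real.pi_ne_zero]
  constructor
  · rintro ⟨n, hn⟩
    refine ⟨n, ?_⟩
    rw [mul_comm] at hn
    exact_mod_cast (mul_right_cancel₀ h hn).symm
  · rintro ⟨n, hn⟩
    refine ⟨n, ?_⟩
    rw [← hn]
    push_cast
    ring

lemma expTwoPiI_mul_fract (n : ℤ) (t : ℝ) :
    expTwoPiI (n * (Int.fract t : ℝ)) = expTwoPiI (n * t) := by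
  have h : (n * t : ℂ) = n * (Int.fract t : ℝ) + (n * ⌊t⌋ : ℤ) := by
    rw [Int.fract]
    push_cast
    ring
  rw [h, expTwoPiI_add, expTwoPiI_int, mul_one]

/-- Pointwise convergence of the Fourier series of a continuous function on the circle with
summable Fourier coefficients. -/
lemma hasSum_fourier {f : ℝ → ℂ} (hc : Continuous f) (h01 : f 0 = f 1) {c : ℤ → ℂ}
    (hcoef : ∀ n : ℤ, ∫ t in (0 : ℝ)..1, expTwoPiI (-n * t) * f t = c n) (hs : Summable c)
    {x : ℝ} (hx : x ∈ Ico (0 : ℝ) 1) :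
    HasSum (fun n : ℤ => c n * expTwoPiI (n * x)) (f x) := by
  have : Fact ((0 : ℝ) < 1) := ⟨one_pos⟩
  let B : C(AddCircle (1 : ℝ), ℂ) := ⟨AddCircle.liftIco 1 0 f,
    AddCircle.liftIco_continuous (by rwa [zero_add]) hc.continuousOn⟩
  have hB : fourierCoeff B = c := by
    funext n
    rw [← hcoef n, ContinuousMap.coe_mk, fourierCoeff_liftIco_eq, fourierCoeffOn_eq_integral]
    simp only [zero_add, sub_zero, div_one, one_smul, smul_eq_mul]
    refine intervalIntegral.integral_congr fun t _ => ?_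
    simp only [fourier_coe_apply, expTwoPiI]
    congr 2
    push_cast
    ring
  have h := has_pointwise_sum_fourier_series_of_summable (f := B) (by rwa [hB]) x
  rw [hB, ContinuousMap.coe_mk, AddCircle.liftIco_coe_apply (by simpa using hx)] at h
  refine h.congr_fun fun n => ?_
  rw [smul_eq_mul, fourier_coe_apply, expTwoPiI]
  congr 2
  push_cast
  ring

lemma integral_exp_mul_linear {l : ℂ} (hl : l ≠ 0) (A B : ℂ) :
    ∫ t in (0 : ℝ)..1, Complex.exp (l * t) * (t * A + B) =
      (Complex.exp l * (A + B) - B) / l - A / l ^ 2 * (Complex.exp l - 1) := by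
  have hd : ∀ t ∈ uIcc (0 : ℝ) 1, HasDerivAt
      (fun t : ℝ => Complex.exp (l * t) * ((t * A + B) / l - A / l ^ 2))
      (Complex.exp (l * t) * (t * A + B)) t := by
    intro t _
    have h1 : HasDerivAt (fun s : ℝ => (s : ℂ)) 1 t := Complex.ofRealCLM.hasDerivAt
    have h2 := ((h1.const_mul l).cexp).mul
      ((((h1.mul_const A).add_const B).div_const l).sub_const (A / l ^ 2))
    refine h2.congr_deriv ?_
    field_simp
    ring
  rw [intervalIntegral.integral_eq_sub_of_hasDerivAt hd
    (Continuous.intervalIntegrable (by fun_prop) _ _)]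
  simp
  field_simp
  ring

lemma integral_exp_mul {l : ℂ} (hl : l ≠ 0) :
    ∫ t in (0 : ℝ)..1, Complex.exp (l * t) = (Complex.exp l - 1) / l := by
  simpa using integral_exp_mul_linear hl 0 1

lemma summable_one_div_add_int_sq (z : ℂ) :
    Summable fun n : ℤ => 1 / (z + n) ^ 2 := by
  have h := EisensteinSeries.linear_right_summable z 1 (k := 2) le_rfl
  refine h.congr fun n => ?_
  simp

/-- Lipschitz's formula, twisted by the additive character `n ↦ e(-n x)`. -/
lemma hasSum_lipschitz {z : ℂ} (hz : 0 < z.im) {x : ℝ} (hx : x ∈ Ico (0 : ℝ) 1) :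
    HasSum (fun n : ℤ => expTwoPiI (-n * x) / (z + n) ^ 2)
      ((2 * Real.pi * Complex.I) ^ 2 * ∑' j : ℕ, ((x + j : ℝ) : ℂ) * expTwoPiI ((x + j : ℝ) * z)) := by
  set Q := expTwoPiI z with hQ
  have hQ1 : ‖Q‖ < 1 := norm_expTwoPiI_lt_one hz
  have hQ0 : 1 - Q ≠ 0 := fun h => by
    rw [sub_eq_zero] at h
    simp [← h] at hQ1
  have hpi : (2 * Real.pi * Complex.I : ℂ) ≠ 0 := by simp [Real.pi_ne_zero]
  have hzn : ∀ n : ℤ, z - n ≠ 0 := fun n h => by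
    have := congrArg Complex.im h
    simp at this
    linarith
  -- the closed form of `∑_j (t + j) Q ^ (t + j)`, whose periodic extension from `[0, 1)` is
  -- continuous and has the Fourier coefficients `((2πi) (z - n))⁻²`
  set f : ℝ → ℂ := fun t => expTwoPiI (t * z) * (t * (1 / (1 - Q)) + Q / (1 - Q) ^ 2) with hf
  have hfx : HasSum (fun j : ℕ => ((x + j : ℝ) : ℂ) * expTwoPiI ((x + j : ℝ) * z)) (f x) := by
    have h1 := (hasSum_geometric_of_norm_lt_one hQ1).mul_left (x : ℂ)
    have h2 := hasSum_coe_mul_geometric_of_norm_lt_one hQ1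
    have h3 := (h1.add h2).mul_left (expTwoPiI (x * z))
    rw [hf]
    convert! h3 using 1
    · funext j
      rw [show ((x + j : ℝ) : ℂ) * z = x * z + j * z by push_cast; ring, expTwoPiI_add,
        expTwoPiI_nat_mul]
      push_cast
      ring
    · rw [one_div]
  rw [hfx.tsum_eq]
  have hcoef : ∀ n : ℤ, ∫ t in (0 : ℝ)..1, expTwoPiI (-n * t) * f t =
      1 / ((2 * Real.pi * Complex.I) * (z - n)) ^ 2 := by
    intro n
    have hl : (2 * Real.pi * Complex.I) * (z - n) ≠ 0 := mul_ne_zero hpi (hzn n)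
    have he : Complex.exp ((2 * Real.pi * Complex.I) * (z - n)) = Q := by
      rw [← expTwoPiI, sub_eq_add_neg, expTwoPiI_add, ← Int.cast_neg, expTwoPiI_int, mul_one]
    have hi : ∀ t : ℝ, expTwoPiI (-n * t) * f t =
        Complex.exp ((2 * Real.pi * Complex.I) * (z - n) * t) *
          (t * (1 / (1 - Q)) + Q / (1 - Q) ^ 2) := by
      intro t
      rw [hf]
      simp only
      rw [← mul_assoc, ← expTwoPiI_add, expTwoPiI]
      ring_nf
    simp only [hi]
    rw [integral_exp_mul_linear hl, he]
    generalize (2 * Real.pi * Complex.I) * (z - n) = l at hl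
    field_simp
    ring
  have hs : Summable fun n : ℤ => 1 / ((2 * Real.pi * Complex.I) * (z - n)) ^ 2 := by
    have h := ((summable_one_div_add_int_sq z).comp_injective neg_injective).mul_left
      (1 / (2 * Real.pi * Complex.I) ^ 2)
    refine h.congr fun n => ?_
    simp only [Function.comp_apply, Int.cast_neg, mul_pow]
    rw [← sub_eq_add_neg]
    field_simp
  have h01 : f 0 = f 1 := by
    simp only [hf, Complex.ofReal_zero, Complex.ofReal_one, zero_mul, one_mul, expTwoPiI_zero,
      ← hQ]
    field_simp
    ring
  have hcont : Continuous f := by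
    simp only [hf, expTwoPiI]
    fun_prop
  have h := ((hasSum_fourier hcont h01 hcoef hs hx).mul_left ((2 * Real.pi * Complex.I) ^ 2))
  rw [← (Equiv.neg ℤ).hasSum_iff] at h
  refine h.congr_fun fun n => ?_
  have := hzn (-n)
  simp only [Function.comp_apply, Equiv.neg_apply, Int.cast_neg, sub_neg_eq_add] at this ⊢
  field_simp

lemma summable_one_div_sq_add_sq {u : ℝ} (hu : 0 < u) :
    Summable fun n : ℤ => (1 : ℂ) / (u ^ 2 + n ^ 2) := by
  have h : Summable fun n : ℤ => ‖(1 : ℂ) / (Complex.I * u + n) ^ 2‖ :=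
    (summable_one_div_add_int_sq (Complex.I * u)).norm
  refine Summable.of_norm (h.congr fun n => ?_)
  have h1 : ‖Complex.I * u + n‖ ^ 2 = u ^ 2 + (n : ℝ) ^ 2 := by
    rw [Complex.sq_norm, Complex.normSq_apply]
    simp
    ring
  have h2 : (u ^ 2 + n ^ 2 : ℂ) = ((u ^ 2 + (n : ℝ) ^ 2 : ℝ) : ℂ) := by push_cast; ring
  rw [norm_div, norm_div, norm_pow, h1, h2, Complex.norm_real, Real.norm_of_nonneg (by positivity)]

/-- The Fourier expansion of the periodised two-sided exponential. -/
lemma hasSum_poissonKernel {u : ℝ} (hu : 0 < u) {x : ℝ} (hx : x ∈ Ico (0 : ℝ) 1) :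
    HasSum (fun n : ℤ => expTwoPiI (-n * x) / (u ^ 2 + n ^ 2))
      (Real.pi / u * ∑' j : ℕ, (expTwoPiI ((x + j : ℝ) * (Complex.I * u)) +
        expTwoPiI ((1 - x + j : ℝ) * (Complex.I * u)))) := by
  set Q := expTwoPiI (Complex.I * u) with hQ
  have hQ1 : ‖Q‖ < 1 := norm_expTwoPiI_lt_one (by simpa using hu)
  have hQ0 : 1 - Q ≠ 0 := fun h => by
    rw [sub_eq_zero] at h
    simp [← h] at hQ1
  have hQn : Q ≠ 0 := Complex.exp_ne_zero _
  have hpi : (Real.pi : ℂ) ≠ 0 := by simp [Real.pi_ne_zero]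
  have hu0 : (u : ℂ) ≠ 0 := by exact_mod_cast hu.ne'
  -- the closed form of `∑_j (Q ^ (t + j) + Q ^ (1 - t + j))`
  set f : ℝ → ℂ := fun t => (expTwoPiI (t * (Complex.I * u)) +
    expTwoPiI ((1 - t) * (Complex.I * u))) * (1 / (1 - Q)) with hf
  have hfx : HasSum (fun j : ℕ => (expTwoPiI ((x + j : ℝ) * (Complex.I * u)) +
        expTwoPiI ((1 - x + j : ℝ) * (Complex.I * u)))) (f x) := by
    have h3 := (hasSum_geometric_of_norm_lt_one hQ1).mul_left
      (expTwoPiI (x * (Complex.I * u)) + expTwoPiI ((1 - x) * (Complex.I * u)))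
    rw [hf]
    convert! h3 using 1
    · funext j
      rw [← expTwoPiI_nat_mul, add_mul, ← expTwoPiI_add, ← expTwoPiI_add]
      push_cast
      ring_nf
    · rw [one_div]
  rw [hfx.tsum_eq]
  have hne : ∀ n : ℤ, (u : ℂ) + n * Complex.I ≠ 0 := fun n h => by
    have := congrArg Complex.re h
    simp at this
    linarith
  have hsq : ∀ n : ℤ, (u ^ 2 + n ^ 2 : ℂ) = (u + n * Complex.I) * (u + (-n : ℤ) * Complex.I) := by
    intro n
    push_cast
    linear_combination (n : ℂ) ^ 2 * Complex.I_sq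
  have hcoef : ∀ n : ℤ, ∫ t in (0 : ℝ)..1, expTwoPiI (-n * t) * f t =
      u / Real.pi * (1 / (u ^ 2 + n ^ 2)) := by
    intro n
    have h1 := hne n
    have h2 := hne (-n)
    have hl1 : -(2 * Real.pi * (u + n * Complex.I)) ≠ 0 :=
      neg_ne_zero.2 (mul_ne_zero (mul_ne_zero two_ne_zero hpi) h1)
    have hl2 : (2 * Real.pi * (u + (-n : ℤ) * Complex.I)) ≠ 0 :=
      mul_ne_zero (mul_ne_zero two_ne_zero hpi) h2
    have he1 : Complex.exp (-(2 * Real.pi * (u + n * Complex.I))) = Q := by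
      have h3 := expTwoPiI_add (Complex.I * u) (-n : ℤ)
      rw [expTwoPiI_int, mul_one, ← hQ] at h3
      rw [← h3, expTwoPiI]
      congr 1
      push_cast
      linear_combination (-2 * Real.pi * u : ℂ) * Complex.I_sq
    have he2 : Complex.exp (2 * Real.pi * (u + (-n : ℤ) * Complex.I)) = Q⁻¹ := by
      have h3 := expTwoPiI_add (-(Complex.I * u)) (-n : ℤ)
      rw [expTwoPiI_int, mul_one, expTwoPiI_neg, ← hQ] at h3
      rw [← h3, expTwoPiI]
      congr 1
      push_cast
      linear_combination (2 * Real.pi * u : ℂ) * Complex.I_sq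
    have hi : ∀ t : ℝ, expTwoPiI (-n * t) * f t =
        (Complex.exp (-(2 * Real.pi * (u + n * Complex.I)) * t) +
          Q * Complex.exp (2 * Real.pi * (u + (-n : ℤ) * Complex.I) * t)) * (1 / (1 - Q)) := by
      intro t
      rw [hf, hQ]
      simp only
      rw [← mul_assoc, mul_add, ← expTwoPiI_add, ← expTwoPiI_add, expTwoPiI, expTwoPiI, expTwoPiI,
        ← Complex.exp_add]
      congr 3
      · linear_combination (2 * Real.pi * u * t : ℂ) * Complex.I_sq
      · push_cast
        linear_combination (-2 * Real.pi * u * t : ℂ) * Complex.I_sq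
    simp only [hi]
    rw [intervalIntegral.integral_mul_const, intervalIntegral.integral_add
      (Continuous.intervalIntegrable (by fun_prop) _ _)
      (Continuous.intervalIntegrable (by fun_prop) _ _), intervalIntegral.integral_const_mul,
      integral_exp_mul hl1, integral_exp_mul hl2, he1, he2, hsq]
    push_cast at h2 ⊢
    rw [neg_mul] at h2 ⊢
    field_simp
    ring
  have hs := (summable_one_div_sq_add_sq hu).mul_left ((u : ℂ) / Real.pi)
  have h01 : f 0 = f 1 := by
    simp only [hf, Complex.ofReal_zero, Complex.ofReal_one, zero_mul, one_mul, sub_zero, sub_self]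
    ring
  have hcont : Continuous f := by
    simp only [hf, expTwoPiI]
    fun_prop
  have h := ((hasSum_fourier hcont h01 hcoef hs hx).mul_left ((Real.pi : ℂ) / u))
  rw [← (Equiv.neg ℤ).hasSum_iff] at h
  refine h.congr_fun fun n => ?_
  have h4 : (u ^ 2 + n ^ 2 : ℂ) ≠ 0 := by
    rw [hsq]
    exact mul_ne_zero (hne _) (hne _)
  simp only [Function.comp_apply, Equiv.neg_apply, Int.cast_neg, neg_sq]
  field_simp

lemma hasSum_bernoulli_two {x : ℝ} (hx : x ∈ Ico (0 : ℝ) 1) :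
    HasSum (fun n : ℤ => expTwoPiI (-n * x) / (n : ℂ) ^ 2)
      (2 * Real.pi ^ 2 * ((x ^ 2 - x + 1 / 6 : ℝ) : ℂ)) := by
  have h := hasSum_one_div_pow_mul_fourier_mul_bernoulliFun (k := 2) le_rfl (Ico_subset_Icc_self hx)
  rw [← (Equiv.neg ℤ).hasSum_iff] at h
  convert! h using 1
  · funext n
    simp only [Function.comp_apply, Equiv.neg_apply, fourier_coe_apply, expTwoPiI]
    push_cast
    ring_nf
  · rw [bernoulliFun_two]
    simp only [Nat.factorial]
    push_cast
    linear_combination (2 * (Real.pi : ℂ) ^ 2 * (x ^ 2 - x + 1 / 6)) * Complex.I_sq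

/-! ### Conditionally convergent lattice sums -/

/-- If `g` is not absolutely summable over `ℤ × ℤ` but the twisted difference
`g(w) - c g(w - w₀)` is, then the sum of the latter is `1 - c` times the iterated sum of `g`. -/
lemma tsum_sub_mul_shift {g : ℤ × ℤ → ℂ} {c : ℂ} {w₀ : ℤ × ℤ}
    (hD : Summable fun w => g w - c * g (w - w₀)) (hrow : ∀ m, Summable fun n => g (m, n))
    (hR : Summable fun m => ∑' n, g (m, n)) :
    ∑' w, (g w - c * g (w - w₀)) = (1 - c) * ∑' m, ∑' n, g (m, n) := by
  have hshift : ∀ m, Summable fun n => g (m - w₀.1, n - w₀.2) := fun m =>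
    (Equiv.subRight w₀.2).summable_iff.2 (hrow (m - w₀.1))
  have hR' : Summable fun m => ∑' n, g (m - w₀.1, n) := (Equiv.subRight w₀.1).summable_iff.2 hR
  have hin : ∀ m, ∑' n, (g (m, n) - c * g ((m, n) - w₀)) =
      ∑' n, g (m, n) - c * ∑' n, g (m - w₀.1, n) := by
    intro m
    change ∑' n, (g (m, n) - c * g (m - w₀.1, n - w₀.2)) = _
    rw [(hrow m).tsum_sub ((hshift m).mul_left c), tsum_mul_left]
    congr 2
    exact (Equiv.subRight w₀.2).tsum_eq fun n => g (m - w₀.1, n)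
  have hout : ∑' m, ∑' n, g (m - w₀.1, n) = ∑' m, ∑' n, g (m, n) :=
    (Equiv.subRight w₀.1).tsum_eq fun m => ∑' n, g (m, n)
  rw [hD.tsum_prod]
  simp only [hin]
  rw [hR.tsum_sub (hR'.mul_left c), tsum_mul_left, hout]
  ring

/-- Fubini's theorem for conditionally convergent double series whose twisted difference is
absolutely summable: by `tsum_sub_mul_shift`, both iterated sums are `(1 - c)⁻¹` times the sum of the
latter. -/
lemma tsum_tsum_comm_of_shift {g : ℤ × ℤ → ℂ} {c : ℂ} (hc : c ≠ 1) {w₀ : ℤ × ℤ}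
    (hD : Summable fun w => g w - c * g (w - w₀)) (hrow : ∀ m, Summable fun n => g (m, n))
    (hR : Summable fun m => ∑' n, g (m, n)) (hcol : ∀ n, Summable fun m => g (m, n))
    (hC : Summable fun n => ∑' m, g (m, n)) :
    ∑' m, ∑' n, g (m, n) = ∑' n, ∑' m, g (m, n) := by
  have h1 := tsum_sub_mul_shift hD hrow hR
  have hD' : Summable fun w : ℤ × ℤ => g w.swap - c * g (w - w₀.swap).swap :=
    (Equiv.prodComm ℤ ℤ).summable_iff.2 hD
  have h2 := tsum_sub_mul_shift (g := fun w => g w.swap) hD' hcol hC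
  have h3 : ∑' w : ℤ × ℤ, (g w.swap - c * g (w - w₀.swap).swap) =
      ∑' w, (g w - c * g (w - w₀)) :=
    (Equiv.prodComm ℤ ℤ).tsum_eq fun w => g w - c * g (w - w₀)
  rw [h3, h1] at h2
  exact mul_left_cancel₀ (sub_ne_zero.2 hc.symm) h2

/-- The point `m τ + n` of the lattice `ℤ + τ ℤ`. -/
noncomputable def latticePoint (τ : ℂ) (w : ℤ × ℤ) : ℂ := w.1 * τ + w.2

/-- The character `m τ + n ↦ e(m x₂ - n x₁)` of the lattice `ℤ + τ ℤ`. -/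
noncomputable def latticeChar (x : ℝ × ℝ) (w : ℤ × ℤ) : ℂ := expTwoPiI (w.1 * x.2 - w.2 * x.1)

lemma latticePoint_sub (τ : ℂ) (w v : ℤ × ℤ) :
    latticePoint τ (w - v) = latticePoint τ w - latticePoint τ v := by
  simp only [latticePoint, Prod.fst_sub, Prod.snd_sub]
  push_cast
  ring

lemma latticeChar_eq_mul (x : ℝ × ℝ) (w v : ℤ × ℤ) :
    latticeChar x w = latticeChar x v * latticeChar x (w - v) := by
  simp only [latticeChar, Prod.fst_sub, Prod.snd_sub, ← expTwoPiI_add]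
  push_cast
  ring_nf

lemma norm_latticeChar (x : ℝ × ℝ) (w : ℤ × ℤ) : ‖latticeChar x w‖ = 1 := by
  have h := norm_expTwoPiI_ofReal (w.1 * x.2 - w.2 * x.1)
  push_cast at h
  exact h

lemma exists_latticeChar_ne_one {x : ℝ × ℝ} (hx : Int.fract x.1 ≠ 0 ∨ Int.fract x.2 ≠ 0) :
    ∃ w, latticeChar x w ≠ 1 := by
  rcases hx with hx | hx
  · refine ⟨(0, -1), ?_⟩
    simpa [latticeChar, expTwoPiI_ofReal_eq_one_iff] using hx
  · refine ⟨(1, 0), ?_⟩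
    simpa [latticeChar, expTwoPiI_ofReal_eq_one_iff] using hx

lemma exists_mul_norm_le_latticePoint {τ : ℂ} (hτ : 0 < τ.im) :
    ∃ c : ℝ, 0 < c ∧ ∀ w, c * ‖w‖ ≤ ‖latticePoint τ w‖ := by
  refine ⟨EisensteinSeries.r ⟨τ, hτ⟩, EisensteinSeries.r_pos _, fun w => ?_⟩
  by_cases hw : w = 0
  · simp [hw]
  · have h := EisensteinSeries.r_mul_max_le ⟨τ, hτ⟩ (x := ![w.1, w.2]) (by
      intro h
      apply hw
      ext
      · simpa using congrFun h 0
      · simpa using congrFun h 1)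
    have h2 : ‖(![w.1, w.2] : Fin 2 → ℤ)‖ = ‖w‖ := by
      rw [EisensteinSeries.norm_eq_max_natAbs, Prod.norm_def, Int.norm_eq_abs, Int.norm_eq_abs]
      simp [Nat.cast_natAbs]
    rw [h2] at h
    exact h

lemma summable_norm_latticePoint_rpow {τ : ℂ} (hτ : 0 < τ.im) {r : ℝ} (hr : 2 < r) :
    Summable fun w => ‖latticePoint τ w‖ ^ (-r) := by
  obtain ⟨c, hc, hle⟩ := exists_mul_norm_le_latticePoint hτ
  have h := EisensteinSeries.summable_one_div_norm_rpow hr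
  rw [← (finTwoArrowEquiv _).symm.summable_iff] at h
  refine Summable.of_nonneg_of_le (fun w => by positivity) (fun w => ?_) (h.mul_left (c ^ (-r)))
  have h2 : ‖(finTwoArrowEquiv ℤ).symm w‖ = ‖w‖ := by
    rw [finTwoArrowEquiv_symm_apply, EisensteinSeries.norm_eq_max_natAbs, Prod.norm_def,
      Int.norm_eq_abs, Int.norm_eq_abs]
    simp [Nat.cast_natAbs]
  simp only [Function.comp_apply, h2]
  rw [← Real.mul_rpow hc.le (norm_nonneg _)]
  by_cases hw : w = 0
  · simp [hw, latticePoint]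
  · exact Real.rpow_le_rpow_of_nonpos (mul_pos hc (norm_pos_iff.2 hw)) (hle w) (by linarith)

lemma eventually_le_norm_latticePoint {τ : ℂ} (hτ : 0 < τ.im) (B : ℝ) :
    ∀ᶠ w in cofinite, B ≤ ‖latticePoint τ w‖ := by
  obtain ⟨c, hc, hle⟩ := exists_mul_norm_le_latticePoint hτ
  have h : Tendsto (fun w : ℤ × ℤ => ‖w‖) cofinite atTop := by
    rw [← cocompact_eq_cofinite]
    exact tendsto_norm_cocompact_atTop
  filter_upwards [h.eventually_ge_atTop (B / c)] with w hw
  rw [div_le_iff₀ hc] at hw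
  linarith [hle w]

lemma norm_cpow_neg_sub_le {s : ℂ} {M a b ρ : ℝ} (hs : 0 ≤ s.re) (hM : ‖s‖ ≤ M) (hρ : 0 < ρ)
    (ha : ρ ≤ a) (hb : ρ ≤ b) :
    ‖(a : ℂ) ^ (-s) - (b : ℂ) ^ (-s)‖ ≤ M * ρ ^ (-s.re - 1) * |a - b| := by
  by_cases h0 : s = 0
  · simp only [h0, neg_zero, Complex.cpow_zero, sub_self, norm_zero] at hM ⊢
    positivity
  have h := Convex.norm_image_sub_le_of_norm_hasDerivWithin_le (𝕜 := ℝ)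
    (f := fun t : ℝ => (t : ℂ) ^ (-s)) (f' := fun t => -s * (t : ℂ) ^ (-s - 1)) (s := Ici ρ)
    (x := b) (y := a) (C := M * ρ ^ (-s.re - 1)) (fun t ht => ?_) (fun t ht => ?_)
    (convex_Ici ρ) hb ha
  · simpa using h
  · exact (hasDerivAt_ofReal_cpow_const (hρ.trans_le ht).ne' (neg_ne_zero.2 h0)).hasDerivWithinAt
  · have ht0 : 0 < t := hρ.trans_le ht
    rw [norm_mul, norm_neg, Complex.norm_cpow_eq_rpow_re_of_pos ht0]
    refine mul_le_mul hM ?_ (by positivity) ((norm_nonneg _).trans hM)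
    simpa using Real.rpow_le_rpow_of_nonpos hρ ht (by linarith : -s.re - 1 ≤ 0)

/-- The summand `conj(w)² / |w|^{2s}` of the Kronecker series. -/
noncomputable def kroneckerKernel (s w : ℂ) : ℂ := conj w ^ 2 / ((‖w‖ : ℝ) : ℂ) ^ (2 * s)

lemma norm_kroneckerKernel {w : ℂ} (hw : w ≠ 0) (s : ℂ) :
    ‖kroneckerKernel s w‖ = ‖w‖ ^ (-(2 * s.re - 2)) := by
  have h0 : 0 < ‖w‖ := norm_pos_iff.2 hw
  rw [kroneckerKernel, norm_div, norm_pow, RCLike.norm_conj,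
    Complex.norm_cpow_eq_rpow_re_of_pos h0, neg_sub, Real.rpow_sub h0]
  simp

lemma kroneckerKernel_two (w : ℂ) : kroneckerKernel 2 w = 1 / w ^ 2 := by
  by_cases hw : w = 0
  · simp [hw, kroneckerKernel]
  have h1 : ((‖w‖ : ℝ) : ℂ) ^ (2 * 2 : ℂ) = (w * conj w) ^ 2 := by
    rw [Complex.mul_conj, Complex.normSq_eq_norm_sq, show (2 * 2 : ℂ) = ((4 : ℕ) : ℂ) by norm_num,
      Complex.cpow_natCast]
    push_cast
    ring
  have h2 : conj w ≠ 0 := by simpa using hw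
  rw [kroneckerKernel, h1]
  field_simp

/-- Shifting `w` gains one power of `|w|`, locally uniformly in `s`. -/
lemma norm_kroneckerKernel_sub_le {s w v : ℂ} {M : ℝ} (hs : 0 ≤ s.re) (hM : ‖2 * s‖ ≤ M)
    (hw : w ≠ 0) (hv : 2 * ‖v‖ ≤ ‖w‖) :
    ‖kroneckerKernel s w - kroneckerKernel s (w - v)‖ ≤
      ‖v‖ * (3 + M * 2 ^ (M + 3)) * ‖w‖ ^ (1 - 2 * s.re) := by
  have h0 : 0 < ‖w‖ := norm_pos_iff.2 hw
  have hre : (2 * s).re = 2 * s.re := by simp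
  have hM' : 2 * s.re ≤ M := by
    rw [← hre]
    exact (Complex.re_le_norm _).trans hM
  have hlow : ‖w‖ / 2 ≤ ‖w - v‖ := by linarith [norm_sub_norm_le w v]
  have hup : ‖w - v‖ ≤ 2 * ‖w‖ := by linarith [norm_sub_le w v, norm_nonneg v]
  have hcp := norm_cpow_neg_sub_le (by rw [hre]; linarith) hM (half_pos h0)
    (by linarith : ‖w‖ / 2 ≤ ‖w‖) hlow
  rw [hre] at hcp
  have habs : |‖w‖ - ‖w - v‖| ≤ ‖v‖ := by simpa using abs_norm_sub_norm_le w (w - v)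
  have hsplit : kroneckerKernel s w - kroneckerKernel s (w - v) =
      conj v * conj (2 * w - v) * (‖w‖ : ℂ) ^ (-(2 * s)) +
      conj (w - v) ^ 2 * ((‖w‖ : ℂ) ^ (-(2 * s)) - (‖w - v‖ : ℂ) ^ (-(2 * s))) := by
    simp only [kroneckerKernel, div_eq_mul_inv, ← Complex.cpow_neg, map_sub, map_mul,
      Complex.conj_ofNat]
    ring
  have h1 : ‖conj v * conj (2 * w - v) * (‖w‖ : ℂ) ^ (-(2 * s))‖ ≤
      ‖v‖ * 3 * ‖w‖ ^ (1 - 2 * s.re) := by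
    rw [norm_mul, norm_mul, RCLike.norm_conj, RCLike.norm_conj,
      Complex.norm_cpow_eq_rpow_re_of_pos h0, Complex.neg_re, hre, sub_eq_add_neg 1,
      Real.rpow_add h0, Real.rpow_one, ← mul_assoc, mul_assoc ‖v‖ 3]
    have : ‖2 * w - v‖ ≤ 3 * ‖w‖ := by
      have h3 := norm_sub_le (2 * w) v
      rw [norm_mul, Complex.norm_ofNat] at h3
      linarith [norm_nonneg v]
    gcongr
  have h2 : ‖conj (w - v) ^ 2 * ((‖w‖ : ℂ) ^ (-(2 * s)) - (‖w - v‖ : ℂ) ^ (-(2 * s)))‖ ≤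
      ‖v‖ * (M * 2 ^ (M + 3)) * ‖w‖ ^ (1 - 2 * s.re) := by
    have hM0 : 0 ≤ M := (norm_nonneg _).trans hM
    rw [norm_mul, norm_pow, RCLike.norm_conj]
    calc ‖w - v‖ ^ 2 * ‖(‖w‖ : ℂ) ^ (-(2 * s)) - (‖w - v‖ : ℂ) ^ (-(2 * s))‖
        ≤ (2 * ‖w‖) ^ 2 * (M * (‖w‖ / 2) ^ (-(2 * s.re) - 1) * ‖v‖) := by
          gcongr
          exact hcp.trans (by gcongr)
      _ = ‖v‖ * (M * (2 ^ (2 * s.re + 3))) * ‖w‖ ^ (1 - 2 * s.re) := by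
          have e1 : (‖w‖ / 2) ^ (-(2 * s.re) - 1) =
              ‖w‖ ^ (-(2 * s.re) - 1) * 2 ^ (2 * s.re + 1) := by
            rw [Real.div_rpow h0.le two_pos.le, show -(2 * s.re) - 1 = -(2 * s.re + 1) by ring,
              Real.rpow_neg two_pos.le, div_inv_eq_mul]
          have e2 : (2 : ℝ) ^ (2 * s.re + 3) = 2 ^ (2 * s.re + 1) * 4 := by
            rw [show 2 * s.re + 3 = (2 * s.re + 1) + 2 by ring, Real.rpow_add two_pos]
            norm_num
          have e3 : ‖w‖ ^ (1 - 2 * s.re) = ‖w‖ ^ (-(2 * s.re) - 1) * ‖w‖ ^ 2 := by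
            rw [show 1 - 2 * s.re = (-(2 * s.re) - 1) + 2 by ring, Real.rpow_add h0]
            norm_num
          rw [e1, e2, e3]
          ring
      _ ≤ _ := by
          gcongr
          norm_num
  rw [hsplit]
  calc _ ≤ _ := norm_add_le _ _
    _ ≤ _ := add_le_add h1 h2
    _ = _ := by ring

/-! ### Analytic continuation of the Kronecker series -/

lemma kroneckerSeries_eq_tsum {τ : ℂ} (hτ : 0 < τ.im) (x : ℝ × ℝ) (s : ℂ) :
    kroneckerSeries 2 0 (x.1 * τ + x.2) s τ =
      ∑' w, latticeChar x w * kroneckerKernel s (latticePoint τ w) := by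
  refine tsum_congr fun w => ?_
  have hsub : τ - conj τ ≠ 0 := by
    rw [Complex.sub_conj]
    simpa using hτ.ne'
  have hpi : (2 * Real.pi * Complex.I : ℂ) ≠ 0 := by simp [Real.pi_ne_zero]
  change (if latticePoint τ w = -0 then 0 else _) = _
  split_ifs with h
  · simp [h, kroneckerKernel]
  · rw [mul_div_assoc, kroneckerKernel, map_zero, add_zero, add_zero]
    congr 1
    rw [latticeChar, expTwoPiI, latticeArea]
    congr 1
    simp only [map_add, map_mul, Complex.conj_ofReal, map_intCast]
    field_simp
    ring

lemma IsKroneckerValue.unique {a : ℕ} {x x₀ s τ v v' : ℂ} (h : IsKroneckerValue a x x₀ s τ v)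
    (h' : IsKroneckerValue a x x₀ s τ v') : v = v' := by
  obtain ⟨r, hr, F, hF, hFs, rfl⟩ := h
  obtain ⟨r', hr', G, hG, hGs, rfl⟩ := h'
  set ρ := max r r'
  have hopen : IsOpen {z : ℂ | ρ < z.re} := isOpen_lt continuous_const Complex.continuous_re
  have hFρ : AnalyticOnNhd ℂ F {z : ℂ | ρ < z.re} :=
    (hF.mono fun z hz => (le_max_left r r').trans_lt hz).analyticOnNhd hopen
  have hGρ : AnalyticOnNhd ℂ G {z : ℂ | ρ < z.re} :=
    (hG.mono fun z hz => (le_max_right r r').trans_lt hz).analyticOnNhd hopen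
  have hpre : IsPreconnected {z : ℂ | ρ < z.re} := (convex_halfSpace_re_gt ρ).isPreconnected
  set σ : ℝ := max ρ (1 + (a : ℝ) / 2) + 1
  have hσ : max ρ (1 + (a : ℝ) / 2) < ((σ : ℝ) : ℂ).re := by simp [σ]
  refine hFρ.eqOn_of_preconnected_of_eventuallyEq hGρ hpre (z₀ := (σ : ℂ))
    ((le_max_left _ _).trans_lt hσ) ?_ (max_lt hr hr')
  have hnhds : {z : ℂ | max ρ (1 + (a : ℝ) / 2) < z.re} ∈ 𝓝 (σ : ℂ) :=
    (isOpen_lt continuous_const Complex.continuous_re).mem_nhds hσ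
  filter_upwards [hnhds] with z hz
  have h1 : ρ < z.re := (le_max_left _ _).trans_lt hz
  have h2 : 1 + (a : ℝ) / 2 < z.re := (le_max_right _ _).trans_lt hz
  rw [hFs z ((le_max_left r r').trans_lt h1) h2, hGs z ((le_max_right r r').trans_lt h1) h2]

lemma IsKroneckerValue.kroneckerK_eq {a : ℕ} {x x₀ s τ v : ℂ}
    (h : IsKroneckerValue a x x₀ s τ v) : kroneckerK a x x₀ s τ = v := by
  have hex : ∃ v, IsKroneckerValue a x x₀ s τ v := ⟨v, h⟩
  rw [kroneckerK, dif_pos hex]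
  exact hex.choose_spec.unique h

lemma summable_kroneckerKernel {τ : ℂ} (hτ : 0 < τ.im) (x : ℝ × ℝ) {s : ℂ} (hs : 2 < s.re) :
    Summable fun w => latticeChar x w * kroneckerKernel s (latticePoint τ w) := by
  refine (summable_norm_latticePoint_rpow hτ (r := 2 * s.re - 2)
    (by linarith)).of_norm_bounded_eventually ?_
  filter_upwards [eventually_le_norm_latticePoint hτ 1] with w hw
  have h0 : latticePoint τ w ≠ 0 := norm_pos_iff.1 (one_pos.trans_le hw)
  rw [norm_mul, norm_latticeChar, one_mul, norm_kroneckerKernel h0]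

/-- The summand of the twisted difference of the Kronecker series, which converges for
`Re s > 3 / 2`. -/
noncomputable def kroneckerDiff (x : ℝ × ℝ) (τ : ℂ) (v w : ℤ × ℤ) (s : ℂ) : ℂ :=
  latticeChar x w * kroneckerKernel s (latticePoint τ w) -
    latticeChar x v * (latticeChar x (w - v) * kroneckerKernel s (latticePoint τ (w - v)))

/-- The bound `7 / 4` on `Re s` leaves room for a uniform exponent `-5 / 2 < -2` of `|w|`. -/
lemma summableLocallyUniformlyOn_kroneckerDiff {τ : ℂ} (hτ : 0 < τ.im) (x : ℝ × ℝ) (v : ℤ × ℤ) :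
    SummableLocallyUniformlyOn (kroneckerDiff x τ v) {s : ℂ | 7 / 4 < s.re} := by
  refine SummableLocallyUniformlyOn.of_locally_bounded_eventually
    (isOpen_lt continuous_const Complex.continuous_re) fun K hK hKc => ?_
  obtain ⟨M, hM⟩ := hKc.exists_bound_of_continuousOn (f := fun s : ℂ => 2 * s) (by fun_prop)
  set C := ‖latticePoint τ v‖ * (3 + |M| * 2 ^ (|M| + 3)) with hC
  refine ⟨fun w => C * ‖latticePoint τ w‖ ^ (-(5 / 2) : ℝ),
    (summable_norm_latticePoint_rpow hτ (by norm_num)).mul_left C, ?_⟩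
  filter_upwards [eventually_le_norm_latticePoint hτ 1,
    eventually_le_norm_latticePoint hτ (2 * ‖latticePoint τ v‖)] with w hw1 hw2 s hs
  have h0 : latticePoint τ w ≠ 0 := norm_pos_iff.1 (one_pos.trans_le hw1)
  have hre : 7 / 4 < s.re := hK hs
  have heq : kroneckerDiff x τ v w s = latticeChar x w *
      (kroneckerKernel s (latticePoint τ w) -
        kroneckerKernel s (latticePoint τ w - latticePoint τ v)) := by
    rw [kroneckerDiff, ← mul_assoc, ← latticeChar_eq_mul, latticePoint_sub]
    ring
  rw [heq, norm_mul, norm_latticeChar, one_mul]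
  refine (norm_kroneckerKernel_sub_le (by linarith) ((hM s hs).trans (le_abs_self M))
    h0 hw2).trans ?_
  rw [← hC]
  have hC0 : 0 ≤ C := by positivity
  exact mul_le_mul_of_nonneg_left (Real.rpow_le_rpow_of_exponent_le hw1 (by linarith)) hC0

lemma summable_kroneckerDiff {τ : ℂ} (hτ : 0 < τ.im) (x : ℝ × ℝ) (v : ℤ × ℤ) {s : ℂ}
    (hs : 7 / 4 < s.re) : Summable fun w => kroneckerDiff x τ v w s :=
  (summableLocallyUniformlyOn_kroneckerDiff hτ x v).summable hs

lemma differentiableOn_tsum_kroneckerDiff {τ : ℂ} (hτ : 0 < τ.im) (x : ℝ × ℝ) (v : ℤ × ℤ) :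
    DifferentiableOn ℂ (fun s => ∑' w, kroneckerDiff x τ v w s) {s : ℂ | 7 / 4 < s.re} := by
  refine (summableLocallyUniformlyOn_kroneckerDiff hτ x v).differentiableOn
    (isOpen_lt continuous_const Complex.continuous_re) fun w s _ => ?_
  have hk : ∀ u : ℂ, DifferentiableAt ℂ (fun s => kroneckerKernel s u) s := by
    intro u
    by_cases hu : u = 0
    · simp [hu, kroneckerKernel]
    have h1 : ((‖u‖ : ℝ) : ℂ) ≠ 0 := by simpa using hu
    simp only [kroneckerKernel, div_eq_mul_inv, ← Complex.cpow_neg]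
    exact (DifferentiableAt.const_cpow (by fun_prop) (Or.inl h1)).const_mul _
  unfold kroneckerDiff
  exact ((hk _).const_mul _).sub (((hk _).const_mul _).const_mul _)

/-- The value at `s = 2` of the Kronecker series is given by Eisenstein summation: by
`tsum_sub_mul_shift`, the continuation is `(1 - χ(v))⁻¹` times the sum of twisted differences, and
this holds at `s = 2` too, provided that the sum over rows converges there. -/
theorem isKroneckerValue_two {τ : ℂ} (hτ : 0 < τ.im) {x : ℝ × ℝ}
    (hx : Int.fract x.1 ≠ 0 ∨ Int.fract x.2 ≠ 0)
    (hR : Summable fun m : ℤ => ∑' n : ℤ, latticeChar x (m, n) / (m * τ + n) ^ 2) :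
    IsKroneckerValue 2 0 (x.1 * τ + x.2) 2 τ
      (∑' m : ℤ, ∑' n : ℤ, latticeChar x (m, n) / (m * τ + n) ^ 2) := by
  obtain ⟨v, hv⟩ := exists_latticeChar_ne_one hx
  have hv' : 1 - latticeChar x v ≠ 0 := sub_ne_zero.2 hv.symm
  refine ⟨7 / 4, by norm_num,
    fun s => (1 - latticeChar x v)⁻¹ * ∑' w, kroneckerDiff x τ v w s,
    (differentiableOn_tsum_kroneckerDiff hτ x v).const_mul _, fun s hs hs2 => ?_, ?_⟩
  · have hs' : 2 < s.re := by
      norm_num at hs2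
      exact hs2
    have hsum := summable_kroneckerKernel hτ x hs'
    have h := tsum_sub_mul_shift (c := latticeChar x v) (w₀ := v)
      (g := fun w => latticeChar x w * kroneckerKernel s (latticePoint τ w))
      (summable_kroneckerDiff hτ x v hs) (fun m => hsum.prod_factor m) hsum.prod
    rw [kroneckerSeries_eq_tsum hτ, hsum.tsum_prod]
    change (1 - latticeChar x v)⁻¹ * (∑' w, _) = _
    rw [show ∑' w, kroneckerDiff x τ v w s = _ from h, inv_mul_cancel_left₀ hv']
  · have hg : ∀ m n : ℤ, latticeChar x (m, n) * kroneckerKernel 2 (latticePoint τ (m, n)) =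
        latticeChar x (m, n) / (m * τ + n) ^ 2 := by
      intro m n
      rw [kroneckerKernel_two, latticePoint, mul_one_div]
    have h := tsum_sub_mul_shift (c := latticeChar x v) (w₀ := v)
      (g := fun w => latticeChar x w * kroneckerKernel 2 (latticePoint τ w))
      (summable_kroneckerDiff hτ x v (by norm_num)) (fun m => ?_) ?_
    · change (1 - latticeChar x v)⁻¹ * (∑' w, kroneckerDiff x τ v w 2) = _
      rw [show ∑' w, kroneckerDiff x τ v w 2 = _ from h, inv_mul_cancel_left₀ hv']
      simp only [hg]
    · simp only [hg]
      refine Summable.of_norm ((EisensteinSeries.linear_right_summable τ m (k := 2)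
        le_rfl).norm.congr fun n => ?_)
      rw [norm_div, norm_latticeChar, norm_inv, one_div]
      norm_cast
    · simpa only [hg] using hR

/-- Under `τ ↦ -1/τ` the value `K₂(0, ·, 2; τ)` is multiplied by `τ²`, and the parameter is
rotated. Both are visible term by term on the series, with `|τ|^{2s} / conj(τ)²` as factor. -/
theorem IsKroneckerValue.inv {y : ℝ} (hy : 0 < y) {x : ℝ × ℝ} {v : ℂ}
    (h : IsKroneckerValue 2 0 ((x.2 : ℝ) * (Complex.I * y) + (-x.1 : ℝ)) 2 (Complex.I * y) v) :
    IsKroneckerValue 2 0 (x.1 * (Complex.I * (1 / y : ℝ)) + x.2) 2 (Complex.I * (1 / y : ℝ))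
      (-(y : ℂ) ^ 2 * v) := by
  obtain ⟨r, hr, F, hF, hFs, rfl⟩ := h
  have hyC : (y : ℂ) ≠ 0 := by exact_mod_cast hy.ne'
  refine ⟨r, hr, fun s => -((y : ℂ) ^ (2 * s - 2) * F s), ?_, fun s hs hs2 => ?_, ?_⟩
  · refine (DifferentiableOn.mul ?_ hF).neg
    exact DifferentiableOn.const_cpow (by fun_prop) (Or.inl hyC)
  · have hker : ∀ w : ℤ × ℤ, kroneckerKernel s (latticePoint (Complex.I * (1 / y : ℝ)) w) =
        -(y : ℂ) ^ (2 * s - 2) * kroneckerKernel s (latticePoint (Complex.I * y) (w.2, -w.1)) := by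
      intro w
      have h1 : latticePoint (Complex.I * (1 / y : ℝ)) w =
          -Complex.I * (y⁻¹ : ℝ) * latticePoint (Complex.I * y) (w.2, -w.1) := by
        simp only [latticePoint]
        push_cast
        field_simp
        linear_combination ((w.2 : ℂ) * y) * Complex.I_sq
      rw [h1]
      generalize latticePoint (Complex.I * y) (w.2, -w.1) = u
      have h2 : ‖-Complex.I * (y⁻¹ : ℝ) * u‖ = y⁻¹ * ‖u‖ := by
        rw [norm_mul, norm_mul, norm_neg, Complex.norm_I, one_mul, Complex.norm_real,
          Real.norm_of_nonneg (by positivity)]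
      have h3 : ((y⁻¹ : ℝ) : ℂ) ^ (2 * s) = ((y : ℂ) ^ (2 * s))⁻¹ := by
        rw [Complex.ofReal_inv, Complex.inv_cpow]
        rw [Complex.arg_ofReal_of_nonneg hy.le]
        exact Real.pi_pos.ne
      rw [kroneckerKernel, kroneckerKernel, h2, Complex.ofReal_mul,
        Complex.mul_cpow_ofReal_nonneg (by positivity) (norm_nonneg _), h3,
        Complex.cpow_sub _ _ hyC]
      simp only [map_mul, map_neg, Complex.conj_I, Complex.conj_ofReal, neg_neg]
      have h4 : (y : ℂ) ^ (2 * s) ≠ 0 := by simp [Complex.cpow_eq_zero_iff, hyC]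
      push_cast
      rw [Complex.cpow_ofNat]
      field_simp
      simp [neg_div]
    have hchar : ∀ w : ℤ × ℤ, latticeChar x w = latticeChar (x.2, -x.1) (w.2, -w.1) := by
      intro w
      simp only [latticeChar]
      push_cast
      ring_nf
    simp only
    rw [hFs s hs hs2, kroneckerSeries_eq_tsum (by simpa using hy) (x.2, -x.1),
      kroneckerSeries_eq_tsum (by simpa using hy) x]
    simp only [hker]
    let e : ℤ × ℤ ≃ ℤ × ℤ := (Equiv.prodComm ℤ ℤ).trans ((Equiv.refl ℤ).prodCongr (Equiv.neg ℤ))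
    rw [← e.tsum_eq, ← neg_mul, ← tsum_mul_left]
    refine tsum_congr fun w => ?_
    change _ * (latticeChar (x.2, -x.1) (w.2, -w.1) *
      kroneckerKernel s (latticePoint (Complex.I * y) (w.2, -w.1))) = _
    rw [← hchar]
    ring
  · simp only
    rw [show (2 * 2 - 2 : ℂ) = ((2 : ℕ) : ℂ) by norm_num, Complex.cpow_natCast]
    ring

/-! ### Lambert series and the q-expansion of Eisenstein series -/

/-- The term `(β + j) ζ^k q^{k (β + j)}` of the Lambert series, with `k = p.1 + 1`, `j = p.2`. -/
noncomputable def lambertTerm (β : ℝ) (ζ τ : ℂ) (p : ℕ × ℕ) : ℂ :=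
  ζ ^ (p.1 + 1) * (((β + p.2 : ℝ) : ℂ) * expTwoPiI ((β + p.2 : ℝ) * ((p.1 + 1 : ℕ) * τ)))

/-- The Lambert series `∑_{k ≥ 1} ∑_{j ≥ 0} (β + j) ζ^k q^{k (β + j)}`. -/
noncomputable def lambertSum (β : ℝ) (ζ τ : ℂ) : ℂ := ∑' p, lambertTerm β ζ τ p

/-- The smallest positive element of `β + ℕ`, for `β ≥ 0`. It is the exponent of the leading term of
the Lambert series, since a term with exponent `0` has coefficient `0`. -/
noncomputable def leastExponent (β : ℝ) : ℝ := if β = 0 then 1 else β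

section Lambert

variable {β : ℝ} {ζ τ : ℂ}

lemma leastExponent_pos (hβ : 0 ≤ β) : 0 < leastExponent β := by
  rw [leastExponent]
  split_ifs with h
  · exact one_pos
  · exact lt_of_le_of_ne hβ (Ne.symm h)

lemma eq_zero_or_leastExponent_le (hβ : 0 ≤ β) (j : ℕ) :
    β + j = 0 ∨ leastExponent β ≤ β + j := by
  rw [leastExponent]
  split_ifs with h
  · rcases Nat.eq_zero_or_pos j with rfl | hj
    · left
      simp [h]
    · right
      have : (1 : ℝ) ≤ j := by exact_mod_cast hj
      linarith
  · right
    have : (0 : ℝ) ≤ j := j.cast_nonneg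
    linarith

lemma norm_lambertTerm (hβ : 0 ≤ β) (hζ : ‖ζ‖ = 1) (p : ℕ × ℕ) :
    ‖lambertTerm β ζ τ p‖ =
      (β + p.2) * Real.exp (-(2 * Real.pi * ((β + p.2) * ((p.1 + 1) * τ.im)))) := by
  have h : 0 ≤ β + p.2 := by positivity
  rw [lambertTerm, norm_mul, norm_pow, hζ, one_pow, one_mul, norm_mul, norm_expTwoPiI,
    Complex.norm_real, Real.norm_of_nonneg h]
  simp

lemma summable_norm_lambertTerm (hβ : 0 ≤ β) (hζ : ‖ζ‖ = 1) (hτ : 0 < τ.im) :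
    Summable fun p => ‖lambertTerm β ζ τ p‖ := by
  set δ := leastExponent β
  have hδ : 0 < δ := leastExponent_pos hβ
  set r := Real.exp (-(Real.pi * τ.im)) with hr
  have hr1 : r < 1 := by
    rw [hr, Real.exp_lt_one_iff]
    have := Real.pi_pos
    nlinarith
  have hr0 : 0 < r := Real.exp_pos _
  set ρ := Real.exp (-(Real.pi * τ.im * δ)) with hρ
  have hρ1 : ρ < 1 := by
    rw [hρ, Real.exp_lt_one_iff]
    have := Real.pi_pos
    have : 0 < Real.pi * τ.im * δ := by positivity
    linarith
  have hρ0 : 0 < ρ := Real.exp_pos _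
  have h1 : Summable fun k : ℕ => ρ ^ (k + 1) :=
    (summable_nat_add_iff 1).2 (summable_geometric_of_lt_one hρ0.le hρ1)
  have h2 : Summable fun j : ℕ => (β + j) * r ^ j := by
    have ha := (summable_geometric_of_lt_one hr0.le hr1).mul_left β
    have hb := summable_pow_mul_geometric_of_norm_lt_one 1 (r := r)
      (by rwa [Real.norm_of_nonneg hr0.le])
    refine (ha.add hb).congr fun j => ?_
    ring
  refine Summable.of_nonneg_of_le (fun _ => norm_nonneg _) (fun p => ?_)
    (h1.mul_of_nonneg h2 (fun k => by positivity) (fun j => by positivity))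
  rw [norm_lambertTerm hβ hζ, mul_left_comm (ρ ^ (p.1 + 1))]
  have hβj : 0 ≤ β + p.2 := by positivity
  rcases eq_zero_or_leastExponent_le hβ p.2 with h | h
  · simp [h]
  · refine mul_le_mul_of_nonneg_left ?_ hβj
    rw [hr, hρ, ← Real.exp_nat_mul, ← Real.exp_nat_mul, ← Real.exp_add, Real.exp_le_exp]
    have hk : (0 : ℝ) ≤ p.1 := p.1.cast_nonneg
    have e1 : (p.2 : ℝ) ≤ (β + p.2) * (p.1 + 1) := by nlinarith
    have e2 : δ * (p.1 + 1) ≤ (β + p.2) * (p.1 + 1) := by gcongr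
    have e3 : 0 < Real.pi * τ.im := by positivity
    push_cast
    nlinarith [mul_le_mul_of_nonneg_left (add_le_add e1 e2) e3.le]

lemma summable_lambertTerm (hβ : 0 ≤ β) (hζ : ‖ζ‖ = 1) (hτ : 0 < τ.im) :
    Summable (lambertTerm β ζ τ) := (summable_norm_lambertTerm hβ hζ hτ).of_norm

lemma expDecay_lambertSum (hβ : 0 ≤ β) (hζ : ‖ζ‖ = 1) :
    ExpDecay fun y => lambertSum β ζ (Complex.I * y) := by
  have hδ := leastExponent_pos hβ
  set δ := leastExponent β
  have hI : 0 < Complex.I.im := by simp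
  refine ⟨2 * Real.pi * δ, by positivity, IsBigO.of_bound
    (Real.exp (2 * Real.pi * δ) * ∑' p, ‖lambertTerm β ζ Complex.I p‖) ?_⟩
  filter_upwards [eventually_ge_atTop 1] with y hy
  have hy0 : 0 < y := by linarith
  have hs := summable_norm_lambertTerm hβ hζ (τ := Complex.I * y) (by simpa using hy0)
  rw [Real.norm_of_nonneg (Real.exp_pos _).le, mul_right_comm, ← Real.exp_add, ← tsum_mul_left]
  refine (norm_tsum_le_tsum_norm hs).trans (hs.tsum_le_tsum (fun p => ?_)
    ((summable_norm_lambertTerm hβ hζ hI).mul_left _))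
  rw [norm_lambertTerm hβ hζ, norm_lambertTerm hβ hζ, mul_left_comm (Real.exp _)]
  have hβj : 0 ≤ β + p.2 := by positivity
  rcases eq_zero_or_leastExponent_le hβ p.2 with h | h
  · simp [h]
  · refine mul_le_mul_of_nonneg_left ?_ hβj
    rw [← Real.exp_add, Real.exp_le_exp]
    have hk : (0 : ℝ) ≤ p.1 := p.1.cast_nonneg
    have e2 : δ * 1 ≤ (β + p.2) * (p.1 + 1) := by
      gcongr
      linarith
    have e3 : 0 ≤ ((β + p.2) * (p.1 + 1) - δ) * (y - 1) :=
      mul_nonneg (by linarith) (by linarith)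
    have hpi := Real.pi_pos
    simp only [Complex.mul_im, Complex.I_re, Complex.I_im, Complex.ofReal_re, Complex.ofReal_im]
    nlinarith

lemma hasSum_lambertSum_rows (hβ : 0 ≤ β) (hζ : ‖ζ‖ = 1) (hτ : 0 < τ.im) :
    HasSum (fun k : ℕ => ζ ^ (k + 1) * ∑' j : ℕ, ((β + j : ℝ) : ℂ) *
      expTwoPiI ((β + j : ℝ) * ((k + 1 : ℕ) * τ))) (lambertSum β ζ τ) := by
  have hs := summable_lambertTerm hβ hζ hτ
  refine (hs.hasSum.prod_fiberwise fun k => (hs.prod_factor k).hasSum).congr_fun fun k => ?_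
  simp only [lambertTerm, tsum_mul_left]

lemma hasSum_lambertSum_columns (hβ : 0 ≤ β) (hζ : ‖ζ‖ = 1) (hτ : 0 < τ.im) :
    HasSum (fun j : ℕ => ((β + j : ℝ) : ℂ) * (expTwoPiI ((β + j : ℝ) * τ) * ζ) /
      (1 - expTwoPiI ((β + j : ℝ) * τ) * ζ)) (lambertSum β ζ τ) := by
  have hs := summable_lambertTerm hβ hζ hτ
  have hs' : Summable fun p : ℕ × ℕ => lambertTerm β ζ τ p.swap :=
    (Equiv.prodComm ℕ ℕ).summable_iff.2 hs
  have heq : ∑' p : ℕ × ℕ, lambertTerm β ζ τ p.swap = lambertSum β ζ τ :=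
    (Equiv.prodComm ℕ ℕ).tsum_eq _
  rw [← heq]
  refine (hs'.hasSum.prod_fiberwise fun j => (hs'.prod_factor j).hasSum).congr_fun fun j => ?_
  simp only [lambertTerm, Prod.swap_prod_mk]
  rcases eq_zero_or_leastExponent_le hβ j with h | h
  · simp [h]
  · have hpos : 0 < β + j := (leastExponent_pos hβ).trans_le h
    set Q := expTwoPiI ((β + j : ℝ) * τ) * ζ with hQ
    have hQ1 : ‖Q‖ < 1 := by
      rw [hQ, norm_mul, hζ, mul_one]
      refine norm_expTwoPiI_lt_one ?_
      rw [Complex.im_ofReal_mul]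
      positivity
    have h3 : ∀ k : ℕ, ζ ^ (k + 1) * (((β + j : ℝ) : ℂ) *
        expTwoPiI ((β + j : ℝ) * ((k + 1 : ℕ) * τ))) = ((β + j : ℝ) : ℂ) * Q * Q ^ k := by
      intro k
      rw [mul_left_comm (((β + j : ℝ) : ℂ)) ((k + 1 : ℕ) : ℂ) τ, expTwoPiI_nat_mul, hQ]
      ring
    simp only [h3]
    rw [tsum_mul_left, tsum_geometric_of_norm_lt_one hQ1]
    rfl

end Lambert

/-- `hasSum_lipschitz` with the conjugate character `n ↦ e(n x)`. This is the formula for `1 - x`,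
except that for `x = 0` it is the formula for `0`, without the vanishing term `j = 0`. -/
lemma hasSum_lipschitz_neg {z : ℂ} (hz : 0 < z.im) {x : ℝ} (hx : x ∈ Ico (0 : ℝ) 1) :
    HasSum (fun n : ℤ => expTwoPiI (n * x) / (z + n) ^ 2)
      ((2 * Real.pi * Complex.I) ^ 2 *
        ∑' j : ℕ, ((1 - x + j : ℝ) : ℂ) * expTwoPiI ((1 - x + j : ℝ) * z)) := by
  rcases eq_or_lt_of_le hx.1 with h0 | h0
  · have h := hasSum_lipschitz hz (x := 0) (by simp)
    have hsum : Summable fun j : ℕ => ((0 + j : ℝ) : ℂ) * expTwoPiI ((0 + j : ℝ) * z) := by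
      have h1 := summable_lambertTerm (β := 0) (ζ := 1) le_rfl (by simp) hz
      refine (h1.prod_factor 0).congr fun j => ?_
      simp [lambertTerm]
    rw [hsum.tsum_eq_zero_add] at h
    simp only [← h0, Complex.ofReal_zero, mul_zero] at h ⊢
    convert! h using 2
    simp only [Nat.cast_zero, add_zero, Complex.ofReal_zero, zero_mul, zero_add]
    refine tsum_congr fun j => ?_
    push_cast
    ring_nf
  · have h := hasSum_lipschitz hz (x := 1 - x) ⟨by linarith [hx.2], by linarith⟩
    refine h.congr_fun fun n => ?_
    congr 1
    have h1 : (-n * ((1 - x : ℝ) : ℂ)) = (-n : ℤ) + n * x := by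
      push_cast
      ring
    rw [h1, expTwoPiI_add, expTwoPiI_int, one_mul]

lemma latticeChar_eq_fract (x : ℝ × ℝ) (m n : ℤ) :
    latticeChar x (m, n) = expTwoPiI (m * x.2) * expTwoPiI (-n * (Int.fract x.1 : ℝ)) := by
  rw [← Int.cast_neg, expTwoPiI_mul_fract, ← expTwoPiI_add, latticeChar]
  push_cast
  ring_nf

/-- Eisenstein summation of the twisted series of `1 / w²`. -/
theorem hasSum_eisenstein_rows {τ : ℂ} (hτ : 0 < τ.im) (x : ℝ × ℝ) :
    HasSum (fun m : ℤ => ∑' n : ℤ, latticeChar x (m, n) / (m * τ + n) ^ 2)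
      (4 * Real.pi ^ 2 * (((Int.fract x.1 ^ 2 - Int.fract x.1 + 1 / 6) / 2 : ℝ) -
        lambertSum (Int.fract x.1) (expTwoPiI x.2) τ -
        lambertSum (1 - Int.fract x.1) (expTwoPiI (-x.2)) τ)) := by
  have hx : Int.fract x.1 ∈ Ico (0 : ℝ) 1 := ⟨Int.fract_nonneg _, Int.fract_lt_one _⟩
  set β := Int.fract x.1 with hβ
  have hζ : ‖expTwoPiI x.2‖ = 1 := norm_expTwoPiI_ofReal _
  have hζ' : ‖expTwoPiI (-x.2)‖ = 1 := by
    rw [← Complex.ofReal_neg]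
    exact norm_expTwoPiI_ofReal _
  have him : ∀ k : ℕ, 0 < (((k + 1 : ℕ) : ℂ) * τ).im := by
    intro k
    rw [← Complex.ofReal_natCast, Complex.im_ofReal_mul]
    positivity
  have hpos := (hasSum_lambertSum_rows hx.1 hζ hτ).mul_left ((2 * Real.pi * Complex.I) ^ 2)
  have hneg := (hasSum_lambertSum_rows (β := 1 - β) (by linarith [hx.2]) hζ' hτ).mul_left
    ((2 * Real.pi * Complex.I) ^ 2)
  have hz := hasSum_bernoulli_two hx
  have hf0 : ∑' n : ℤ, latticeChar x (0, n) / ((0 : ℤ) * τ + n) ^ 2 =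
      2 * Real.pi ^ 2 * ((β ^ 2 - β + 1 / 6 : ℝ) : ℂ) := by
    rw [← hz.tsum_eq]
    refine tsum_congr fun n => ?_
    rw [latticeChar_eq_fract, ← hβ]
    simp [expTwoPiI_zero]
  have hfpos : ∀ k : ℕ, ∑' n : ℤ, latticeChar x ((k + 1 : ℤ), n) / ((k + 1 : ℤ) * τ + n) ^ 2 =
      (2 * Real.pi * Complex.I) ^ 2 * (expTwoPiI x.2 ^ (k + 1) * ∑' j : ℕ, ((β + j : ℝ) : ℂ) *
      expTwoPiI ((β + j : ℝ) * ((k + 1 : ℕ) * τ))) := by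
    intro k
    rw [mul_left_comm, ← (hasSum_lipschitz (him k) hx).tsum_eq, ← tsum_mul_left]
    refine tsum_congr fun n => ?_
    rw [latticeChar_eq_fract, ← hβ, ← expTwoPiI_nat_mul, mul_div_assoc]
    push_cast
    rfl
  have hfneg : ∀ k : ℕ, ∑' n : ℤ, latticeChar x (-(k + 1 : ℤ), n) /
      ((-(k + 1 : ℤ) : ℤ) * τ + n) ^ 2 =
      (2 * Real.pi * Complex.I) ^ 2 * (expTwoPiI (-x.2) ^ (k + 1) *
      ∑' j : ℕ, ((1 - β + j : ℝ) : ℂ) * expTwoPiI ((1 - β + j : ℝ) * ((k + 1 : ℕ) * τ))) := by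
    intro k
    rw [mul_left_comm, ← (hasSum_lipschitz_neg (him k) hx).tsum_eq, ← tsum_mul_left,
      ← (Equiv.neg ℤ).tsum_eq]
    refine tsum_congr fun n => ?_
    rw [Equiv.neg_apply, latticeChar_eq_fract, ← hβ, ← expTwoPiI_nat_mul, mul_div_assoc]
    push_cast
    rw [neg_neg, ← neg_sq]
    ring_nf
  have h := HasSum.of_add_one_of_neg_add_one
    (f := fun m : ℤ => ∑' n : ℤ, latticeChar x (m, n) / (m * τ + n) ^ 2)
    (hpos.congr_fun hfpos) (hneg.congr_fun hfneg)
  rw [hf0] at h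
  convert! h using 1
  push_cast
  linear_combination (-4 * (Real.pi : ℂ) ^ 2 * (lambertSum β (expTwoPiI x.2) τ +
        lambertSum (1 - β) (expTwoPiI (-x.2)) τ)) * Complex.I_sq

/-- The q-expansion of `E^{(2)}_x`. -/
theorem eisenstein_two_eq {τ : ℂ} (hτ : 0 < τ.im) {x : ℝ × ℝ}
    (hx : Int.fract x.1 ≠ 0 ∨ Int.fract x.2 ≠ 0) :
    eisenstein 2 x τ = ((Int.fract x.1 ^ 2 - Int.fract x.1 + 1 / 6) / 2 : ℝ) -
        lambertSum (Int.fract x.1) (expTwoPiI x.2) τ -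
        lambertSum (1 - Int.fract x.1) (expTwoPiI (-x.2)) τ := by
  have h := hasSum_eisenstein_rows hτ x
  have hK := (isKroneckerValue_two hτ hx h.summable).kroneckerK_eq
  have hpi : (Real.pi : ℂ) ≠ 0 := by simp [Real.pi_ne_zero]
  rw [h.tsum_eq] at hK
  rw [eisenstein]
  push_cast at hK ⊢
  rw [hK]
  simp only [Nat.factorial_one, Nat.cast_one, neg_sq, mul_pow, Complex.I_sq]
  field_simp
  ring

/-- The modular transformation `E_x(-1/τ) = τ² E_{(x₂, -x₁)}(τ)` on the imaginary axis. -/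
theorem eisenstein_two_inv {y : ℝ} (hy : 0 < y) {x : ℝ × ℝ}
    (hx : Int.fract x.1 ≠ 0 ∨ Int.fract x.2 ≠ 0) :
    eisenstein 2 x (Complex.I * (1 / y : ℝ)) =
      -(y : ℂ) ^ 2 * eisenstein 2 (x.2, -x.1) (Complex.I * y) := by
  have him : 0 < (Complex.I * y : ℂ).im := by simpa using hy
  have hx' : Int.fract (x.2, -x.1).1 ≠ 0 ∨ Int.fract (x.2, -x.1).2 ≠ 0 := by
    simpa [Int.fract_neg_eq_zero] using hx.symm
  have h := isKroneckerValue_two him hx' (hasSum_eisenstein_rows him _).summable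
  have h1 := h.kroneckerK_eq
  have h2 := (IsKroneckerValue.inv hy (x := x) h).kroneckerK_eq
  rw [← h1] at h2
  rw [eisenstein, eisenstein]
  push_cast at h2 ⊢
  rw [h2]
  ring

/-! ### Siegel units -/

/-- One of the two infinite products in the definition of the Siegel unit. -/
noncomputable def siegelProd (β : ℝ) (ζ τ : ℂ) : ℂ :=
  ∏' j : ℕ, (1 - expTwoPiI ((β + j : ℝ) * τ) * ζ)

lemma siegelUnit_eq (x : ℝ × ℝ) (τ : ℂ) : siegelUnit x τ =
    expTwoPiI (((Int.fract x.1 ^ 2 - Int.fract x.1 + 1 / 6) / 2 : ℝ) * τ) *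
      siegelProd (Int.fract x.1) (expTwoPiI x.2) τ *
      siegelProd (1 - Int.fract x.1) (expTwoPiI (-x.2)) τ := rfl

section SiegelProd

variable {β : ℝ} {ζ τ : ℂ}

lemma norm_siegelFactor (hζ : ‖ζ‖ = 1) (j : ℕ) :
    ‖expTwoPiI ((β + j : ℝ) * τ) * ζ‖ = Real.exp (-(2 * Real.pi * ((β + j) * τ.im))) := by
  rw [norm_mul, hζ, mul_one, norm_expTwoPiI, Complex.im_ofReal_mul]

lemma siegelFactor_ne_zero (hβ : 0 ≤ β) (hζ : ‖ζ‖ = 1) (h : 0 < β ∨ ζ ≠ 1) (hτ : 0 < τ.im)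
    (j : ℕ) : 1 - expTwoPiI ((β + j : ℝ) * τ) * ζ ≠ 0 := by
  intro h0
  rw [sub_eq_zero] at h0
  have h1 : 0 ≤ β + j := by positivity
  rcases h1.eq_or_lt with h2 | h2
  · rw [← h2, Complex.ofReal_zero, zero_mul, expTwoPiI_zero, one_mul] at h0
    have hj : (0 : ℝ) ≤ j := j.cast_nonneg
    rcases h with h | h
    · linarith
    · exact h h0.symm
  · have h3 := norm_siegelFactor (β := β) (τ := τ) hζ j
    rw [← h0, norm_one, eq_comm, Real.exp_eq_one_iff] at h3
    have : 0 < 2 * Real.pi * ((β + j) * τ.im) := by positivity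
    linarith

lemma norm_siegelFactor_le (hβ : 0 ≤ β) (hζ : ‖ζ‖ = 1) {ρ : ℝ} (hρ : 0 ≤ ρ) (hτ : ρ ≤ τ.im)
    (j : ℕ) : ‖expTwoPiI ((β + j : ℝ) * τ) * ζ‖ ≤ Real.exp (-(2 * Real.pi * ρ)) ^ j := by
  rw [norm_siegelFactor hζ, ← Real.exp_nat_mul, Real.exp_le_exp]
  have hj : (0 : ℝ) ≤ j := j.cast_nonneg
  have h1 : (j : ℝ) * ρ ≤ (β + j) * τ.im := by
    refine mul_le_mul (by linarith) hτ hρ (by linarith)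
  nlinarith [Real.pi_pos]

lemma summable_exp_pow {ρ : ℝ} (hρ : 0 < ρ) :
    Summable fun j : ℕ => Real.exp (-(2 * Real.pi * ρ)) ^ j := by
  refine summable_geometric_of_lt_one (Real.exp_pos _).le ?_
  rw [Real.exp_lt_one_iff]
  have := Real.pi_pos
  have : 0 < 2 * Real.pi * ρ := by positivity
  linarith

lemma summable_norm_siegelFactor (hβ : 0 ≤ β) (hζ : ‖ζ‖ = 1) (hτ : 0 < τ.im) :
    Summable fun j : ℕ => ‖-(expTwoPiI ((β + j : ℝ) * τ) * ζ)‖ := by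
  simp only [norm_neg]
  exact Summable.of_nonneg_of_le (fun _ => norm_nonneg _)
    (norm_siegelFactor_le hβ hζ hτ.le le_rfl) (summable_exp_pow hτ)

lemma siegelProd_ne_zero (hβ : 0 ≤ β) (hζ : ‖ζ‖ = 1) (h : 0 < β ∨ ζ ≠ 1) (hτ : 0 < τ.im) :
    siegelProd β ζ τ ≠ 0 := by
  simp only [siegelProd, sub_eq_add_neg]
  refine tprod_one_add_ne_zero_of_summable (fun j => ?_) (summable_norm_siegelFactor hβ hζ hτ)
  rw [← sub_eq_add_neg]
  exact siegelFactor_ne_zero hβ hζ h hτ j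

lemma multipliableLocallyUniformlyOn_siegelProd (hβ : 0 ≤ β) (hζ : ‖ζ‖ = 1) {ρ : ℝ} (hρ : 0 < ρ) :
    MultipliableLocallyUniformlyOn
      (fun (j : ℕ) (τ : ℂ) => 1 - expTwoPiI ((β + j : ℝ) * τ) * ζ) {τ : ℂ | ρ < τ.im} := by
  simp only [sub_eq_add_neg]
  refine (summable_exp_pow hρ).multipliableLocallyUniformlyOn_nat_one_add
    (isOpen_lt continuous_const Complex.continuous_im)
    (Eventually.of_forall fun j τ hτ => ?_) fun j => ?_
  · rw [norm_neg]
    exact norm_siegelFactor_le hβ hζ hρ.le (le_of_lt hτ) j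
  · unfold expTwoPiI
    fun_prop

lemma differentiable_siegelFactor (β : ℝ) (ζ : ℂ) (j : ℕ) :
    Differentiable ℂ fun τ : ℂ => 1 - expTwoPiI ((β + j : ℝ) * τ) * ζ := by
  unfold expTwoPiI
  fun_prop

lemma differentiableAt_siegelProd (hβ : 0 ≤ β) (hζ : ‖ζ‖ = 1) (hτ : 0 < τ.im) :
    DifferentiableAt ℂ (siegelProd β ζ) τ := by
  have hopen : IsOpen {z : ℂ | τ.im / 2 < z.im} := isOpen_lt continuous_const Complex.continuous_im
  have h := (multipliableLocallyUniformlyOn_siegelProd hβ hζ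
    (half_pos hτ)).hasProdLocallyUniformlyOn.differentiableOn
    (.of_forall fun s => by
      simpa [Finset.prod_fn] using DifferentiableOn.finsetProd
        (fun j _ => (differentiable_siegelFactor β ζ j).differentiableOn)) hopen
  exact h.differentiableAt (hopen.mem_nhds (half_lt_self hτ))

lemma logDeriv_siegelFactor (β : ℝ) (ζ τ : ℂ) (j : ℕ) :
    logDeriv (fun τ : ℂ => 1 - expTwoPiI ((β + j : ℝ) * τ) * ζ) τ =
      -(2 * Real.pi * Complex.I) * (((β + j : ℝ) : ℂ) * (expTwoPiI ((β + j : ℝ) * τ) * ζ) /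
      (1 - expTwoPiI ((β + j : ℝ) * τ) * ζ)) := by
  have h : HasDerivAt (fun τ : ℂ => 1 - expTwoPiI ((β + j : ℝ) * τ) * ζ)
      (-(expTwoPiI ((β + j : ℝ) * τ) * (2 * Real.pi * Complex.I * ((β + j : ℝ) * 1)) * ζ)) τ := by
    unfold expTwoPiI
    exact (((((hasDerivAt_id τ).const_mul _).const_mul _).cexp).mul_const ζ).const_sub 1
  rw [logDeriv_apply, h.deriv]
  ring

lemma logDeriv_siegelProd (hβ : 0 ≤ β) (hζ : ‖ζ‖ = 1) (h : 0 < β ∨ ζ ≠ 1) (hτ : 0 < τ.im) :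
    logDeriv (siegelProd β ζ) τ = -(2 * Real.pi * Complex.I) * lambertSum β ζ τ := by
  have hs := (hasSum_lambertSum_columns hβ hζ hτ).mul_left (-(2 * Real.pi * Complex.I))
  simp only [← logDeriv_siegelFactor] at hs
  rw [← hs.tsum_eq]
  exact logDeriv_tprod_eq_tsum (s := {z : ℂ | τ.im / 2 < z.im})
    (isOpen_lt continuous_const Complex.continuous_im) (half_lt_self hτ)
    (siegelFactor_ne_zero hβ hζ h hτ)
    (fun j => (differentiable_siegelFactor β ζ j).differentiableOn) hs.summable
    (multipliableLocallyUniformlyOn_siegelProd hβ hζ (half_pos hτ))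
    (siegelProd_ne_zero hβ hζ h hτ)

lemma siegelProd_zero (hζ : ‖ζ‖ = 1) (hτ : 0 < τ.im) :
    siegelProd 0 ζ τ = (1 - ζ) * siegelProd 1 ζ τ := by
  have hm : Multipliable fun j : ℕ => 1 - expTwoPiI ((1 + j : ℝ) * τ) * ζ := by
    have h := multipliable_one_add_of_summable (summable_norm_siegelFactor (β := 1)
      zero_le_one hζ hτ)
    simpa only [sub_eq_add_neg] using h
  have hm' : Multipliable fun j : ℕ => 1 - expTwoPiI ((0 + (j + 1 : ℕ) : ℝ) * τ) * ζ := by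
    refine hm.congr fun j => ?_
    rw [show (1 + j : ℝ) = 0 + (j + 1 : ℕ) by push_cast; ring]
  have h := tprod_eq_zero_mul' (f := fun j : ℕ => 1 - expTwoPiI ((0 + j : ℝ) * τ) * ζ) hm'
  have h0 : ((0 + (0 : ℕ) : ℝ) : ℂ) * τ = 0 := by simp
  have h1 : ∀ j : ℕ, ((0 + (j + 1 : ℕ) : ℝ) : ℂ) * τ = (1 + j : ℝ) * τ := by
    intro j
    push_cast
    ring
  simp only [h0, h1, expTwoPiI_zero, one_mul] at h
  exact h

lemma norm_siegelProd_sub_one_le (hβ : 0 ≤ β) (hζ : ‖ζ‖ = 1) (hτ : 0 < τ.im) :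
    ‖siegelProd β ζ τ - 1‖ ≤
      Real.exp (∑' j : ℕ, Real.exp (-(2 * Real.pi * ((β + j) * τ.im)))) - 1 := by
  have hs := summable_norm_siegelFactor hβ hζ hτ
  have hm := (multipliable_one_add_of_summable hs).hasProd
  have hs' : ∀ j : ℕ, ‖-(expTwoPiI ((β + j : ℝ) * τ) * ζ)‖ =
      Real.exp (-(2 * Real.pi * ((β + j) * τ.im))) := by
    intro j
    rw [norm_neg, norm_siegelFactor hζ]
  simp only [← sub_eq_add_neg] at hm
  refine le_of_tendsto (hm.sub_const 1).norm (Eventually.of_forall fun t => ?_)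
  have h := t.norm_prod_one_add_sub_one_le fun j : ℕ => -(expTwoPiI ((β + j : ℝ) * τ) * ζ)
  simp only [← sub_eq_add_neg] at h
  refine h.trans ?_
  gcongr
  simp only [hs'] at hs ⊢
  exact hs.sum_le_tsum t fun _ _ => (Real.exp_pos _).le

/-- The decay follows from `|∏ (1 - Q_j) - 1| ≤ exp (∑ |Q_j|) - 1` and `∑ |Q_j| = O(exp(-2πβ y))`. -/
lemma expDecay_siegelProd_sub_one (hβ : 0 < β) (hζ : ‖ζ‖ = 1) :
    ExpDecay fun y => siegelProd β ζ (Complex.I * y) - 1 := by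
  have hsum : ∀ y : ℝ, 0 < y →
      Summable fun j : ℕ => Real.exp (-(2 * Real.pi * ((β + j) * y))) := by
    intro y hy
    have h := summable_norm_siegelFactor hβ.le hζ (τ := Complex.I * y) (by simpa using hy)
    refine h.congr fun j => ?_
    rw [norm_neg, norm_siegelFactor hζ]
    simp
  set s := ∑' j : ℕ, Real.exp (-(2 * Real.pi * ((β + j) * 1))) with hs
  have hs0 : 0 ≤ s := tsum_nonneg fun j => (Real.exp_pos _).le
  refine ⟨2 * Real.pi * β, by positivity, IsBigO.of_bound
    (s * Real.exp (2 * Real.pi * β) * Real.exp s) ?_⟩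
  filter_upwards [eventually_ge_atTop 1] with y hy
  have hy0 : 0 < y := by linarith
  set S := ∑' j : ℕ, Real.exp (-(2 * Real.pi * ((β + j) * y))) with hS
  have hS0 : 0 ≤ S := tsum_nonneg fun j => (Real.exp_pos _).le
  have hle : S ≤ s * Real.exp (2 * Real.pi * β) * Real.exp (-(2 * Real.pi * β) * y) := by
    rw [hS, hs, mul_assoc, ← Real.exp_add, ← tsum_mul_right]
    refine (hsum y hy0).tsum_le_tsum (fun j => ?_) ((hsum 1 one_pos).mul_right _)
    rw [← Real.exp_add, Real.exp_le_exp]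
    have hj : (0 : ℝ) ≤ j := j.cast_nonneg
    have e3 : 0 ≤ Real.pi * (j * (y - 1)) :=
      mul_nonneg Real.pi_pos.le (mul_nonneg hj (by linarith))
    nlinarith
  have hSs : S ≤ s := by
    refine (hsum y hy0).tsum_le_tsum (fun j => ?_) (hsum 1 one_pos)
    have hj : (0 : ℝ) ≤ β + j := by positivity
    have hpi := Real.pi_pos
    gcongr
  have hP := norm_siegelProd_sub_one_le hβ.le hζ (τ := Complex.I * y) (by simpa using hy0)
  have hI : (Complex.I * y : ℂ).im = y := by simp
  rw [hI, ← hS] at hP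
  have hexp : Real.exp S - 1 ≤ S * Real.exp S := by
    have h1 := Real.add_one_le_exp (-S)
    have h2 : Real.exp (-S) * Real.exp S = 1 := by rw [← Real.exp_add]; simp
    nlinarith [Real.exp_pos S]
  rw [Real.norm_of_nonneg (Real.exp_pos _).le]
  calc ‖siegelProd β ζ (Complex.I * y) - 1‖ ≤ S * Real.exp S := hP.trans hexp
    _ ≤ (s * Real.exp (2 * Real.pi * β) * Real.exp (-(2 * Real.pi * β) * y)) * Real.exp s := by
        gcongr
    _ = _ := by ring

end SiegelProd

lemma ExpDecay.log_norm {f : ℝ → ℂ} (hf : ExpDecay fun y => f y - 1) :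
    ExpDecay fun y => (Real.log ‖f y‖ : ℂ) := by
  have ht := hf.tendsto.norm
  rw [norm_zero] at ht
  obtain ⟨δ, hδ, hO⟩ := hf
  refine ⟨δ, hδ, IsBigO.trans (IsBigO.of_bound (3 / 2) ?_) hO⟩
  filter_upwards [ht.eventually_le_const (show (0 : ℝ) < 1 / 2 by norm_num)] with y hy
  have h := Complex.norm_log_one_add_half_le_self hy
  rw [add_sub_cancel] at h
  rw [Complex.norm_real, Real.norm_eq_abs, ← Complex.log_re]
  exact (Complex.abs_re_le_norm _).trans h

/-- The point `x` is not in the lattice `ℤ²`. -/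
def NotIntegral (x : ℝ × ℝ) : Prop := Int.fract x.1 ≠ 0 ∨ Int.fract x.2 ≠ 0

section SiegelUnit

variable {x : ℝ × ℝ}

lemma NotIntegral.pos_or_ne_one (hx : NotIntegral x) :
    0 < Int.fract x.1 ∨ expTwoPiI x.2 ≠ 1 := by
  rcases hx with h | h
  · exact Or.inl (lt_of_le_of_ne (Int.fract_nonneg _) h.symm)
  · exact Or.inr (mt (expTwoPiI_ofReal_eq_one_iff _).1 h)

lemma NotIntegral.rotate (hx : NotIntegral x) : NotIntegral (x.2, -x.1) := by
  simpa [NotIntegral, Int.fract_neg_eq_zero] using Or.symm hx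

lemma norm_expTwoPiI_neg_ofReal (t : ℝ) : ‖expTwoPiI (-t)‖ = 1 := by
  rw [← Complex.ofReal_neg]
  exact norm_expTwoPiI_ofReal _

lemma one_sub_fract_pos (t : ℝ) : 0 < 1 - Int.fract t := by linarith [Int.fract_lt_one t]

lemma siegelUnit_ne_zero (hx : NotIntegral x) {τ : ℂ} (hτ : 0 < τ.im) : siegelUnit x τ ≠ 0 := by
  rw [siegelUnit_eq]
  refine mul_ne_zero (mul_ne_zero (Complex.exp_ne_zero _) ?_) ?_
  · exact siegelProd_ne_zero (Int.fract_nonneg _) (norm_expTwoPiI_ofReal _) hx.pos_or_ne_one hτ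
  · exact siegelProd_ne_zero (one_sub_fract_pos _).le (norm_expTwoPiI_neg_ofReal _)
      (Or.inl (one_sub_fract_pos _)) hτ

lemma differentiableAt_siegelUnit (x : ℝ × ℝ) {τ : ℂ} (hτ : 0 < τ.im) :
    DifferentiableAt ℂ (siegelUnit x) τ := by
  have h : DifferentiableAt ℂ (fun τ : ℂ =>
      expTwoPiI (((Int.fract x.1 ^ 2 - Int.fract x.1 + 1 / 6) / 2 : ℝ) * τ)) τ := by
    unfold expTwoPiI
    fun_prop
  exact (h.mul (differentiableAt_siegelProd (Int.fract_nonneg _) (norm_expTwoPiI_ofReal _)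
    hτ)).mul (differentiableAt_siegelProd (one_sub_fract_pos _).le
      (norm_expTwoPiI_neg_ofReal _) hτ)

/-- The logarithmic derivative of the Siegel unit is `2πi E^{(2)}_x`. -/
theorem logDeriv_siegelUnit (hx : NotIntegral x) {τ : ℂ} (hτ : 0 < τ.im) :
    logDeriv (siegelUnit x) τ = 2 * Real.pi * Complex.I * eisenstein 2 x τ := by
  set b : ℝ := (Int.fract x.1 ^ 2 - Int.fract x.1 + 1 / 6) / 2 with hb
  have h : HasDerivAt (fun τ : ℂ => expTwoPiI (b * τ))
      (expTwoPiI (b * τ) * (2 * Real.pi * Complex.I * (b * 1))) τ := by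
    unfold expTwoPiI
    exact (((hasDerivAt_id τ).const_mul _).const_mul _).cexp
  have h1 := differentiableAt_siegelProd (Int.fract_nonneg x.1) (norm_expTwoPiI_ofReal x.2) hτ
  have h2 := differentiableAt_siegelProd (one_sub_fract_pos x.1).le
    (norm_expTwoPiI_neg_ofReal x.2) hτ
  have n0 : expTwoPiI (b * τ) ≠ 0 := Complex.exp_ne_zero _
  have n1 := siegelProd_ne_zero (Int.fract_nonneg x.1) (norm_expTwoPiI_ofReal x.2)
    hx.pos_or_ne_one hτ
  have n2 := siegelProd_ne_zero (one_sub_fract_pos x.1).le (norm_expTwoPiI_neg_ofReal x.2)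
    (Or.inl (one_sub_fract_pos x.1)) hτ
  have e1 := logDeriv_mul (f := fun τ : ℂ => expTwoPiI (b * τ) *
      siegelProd (Int.fract x.1) (expTwoPiI x.2) τ)
    (g := siegelProd (1 - Int.fract x.1) (expTwoPiI (-x.2))) τ (mul_ne_zero n0 n1) n2
    (h.differentiableAt.mul h1) h2
  have e2 := logDeriv_mul (f := fun τ : ℂ => expTwoPiI (b * τ))
    (g := siegelProd (Int.fract x.1) (expTwoPiI x.2)) τ n0 n1 h.differentiableAt h1
  rw [funext (siegelUnit_eq x)]
  refine e1.trans ?_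
  rw [e2,
    logDeriv_siegelProd (Int.fract_nonneg _) (norm_expTwoPiI_ofReal _) hx.pos_or_ne_one hτ,
    logDeriv_siegelProd (one_sub_fract_pos _).le (norm_expTwoPiI_neg_ofReal _)
      (Or.inl (one_sub_fract_pos _)) hτ, logDeriv_apply, h.deriv, mul_div_cancel_left₀ _ n0,
    eisenstein_two_eq hτ hx]
  ring

lemma im_I_mul_pos {y : ℝ} (hy : 0 < y) : 0 < (Complex.I * y : ℂ).im := by simpa using hy

lemma dlogSiegel_eq (hx : NotIntegral x) {y : ℝ} (hy : 0 < y) :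
    dlogSiegel x y = 2 * Real.pi * Complex.I * eisensteinForm 2 x y := by
  rw [dlogSiegel, logDeriv_siegelUnit hx (im_I_mul_pos hy), eisensteinForm]
  ring

lemma eisensteinForm_eq (hx : NotIntegral x) {y : ℝ} (hy : 0 < y) :
    eisensteinForm 2 x y = (2 * Real.pi * Complex.I)⁻¹ * dlogSiegel x y := by
  have hpi : (2 * Real.pi * Complex.I : ℂ) ≠ 0 := by simp [Real.pi_ne_zero]
  rw [dlogSiegel_eq hx hy, inv_mul_cancel_left₀ hpi]

lemma pullbackSigma_eisensteinForm (hx : NotIntegral x) {y : ℝ} (hy : 0 < y) :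
    pullbackSigma (eisensteinForm 2 x) y = eisensteinForm 2 (x.2, -x.1) y := by
  have hyC : (y : ℂ) ≠ 0 := by exact_mod_cast hy.ne'
  rw [pullbackSigma, eisensteinForm, eisensteinForm, eisenstein_two_inv hy hx]
  field_simp

lemma pullbackSigma_dlogSiegel (hx : NotIntegral x) {y : ℝ} (hy : 0 < y) :
    pullbackSigma (dlogSiegel x) y = dlogSiegel (x.2, -x.1) y := by
  rw [dlogSiegel_eq hx.rotate hy, ← pullbackSigma_eisensteinForm hx hy, pullbackSigma,
    pullbackSigma, dlogSiegel_eq hx (by positivity)]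
  ring

lemma contDiffOn_comp_I_mul {f : ℂ → ℂ} (hf : DifferentiableOn ℂ f {τ : ℂ | 0 < τ.im}) :
    ContDiffOn ℝ ∞ (fun y : ℝ => f (Complex.I * y)) (Ioi 0) := by
  have h1 : ContDiffOn ℝ ∞ f {τ : ℂ | 0 < τ.im} :=
    (hf.contDiffOn (isOpen_lt continuous_const Complex.continuous_im)).restrict_scalars ℝ
  have h2 : ContDiff ℝ ∞ fun y : ℝ => Complex.I * (y : ℂ) :=
    contDiff_const.mul Complex.ofRealCLM.contDiff
  exact h1.comp h2.contDiffOn fun y hy => im_I_mul_pos hy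

lemma contDiffOn_dlogSiegel (hx : NotIntegral x) : ContDiffOn ℝ ∞ (dlogSiegel x) (Ioi 0) := by
  have hopen : IsOpen {τ : ℂ | 0 < τ.im} := isOpen_lt continuous_const Complex.continuous_im
  have hd : DifferentiableOn ℂ (siegelUnit x) {τ : ℂ | 0 < τ.im} := fun τ hτ =>
    (differentiableAt_siegelUnit x hτ).differentiableWithinAt
  have h : DifferentiableOn ℂ (logDeriv (siegelUnit x)) {τ : ℂ | 0 < τ.im} :=
    (hd.deriv hopen).div hd fun τ hτ => siegelUnit_ne_zero hx hτ
  exact (contDiffOn_comp_I_mul h).mul contDiffOn_const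

lemma contDiffOn_logAbsSiegel (hx : NotIntegral x) :
    ContDiffOn ℝ ∞ (logAbsSiegel x) (Ioi 0) := by
  have hd : DifferentiableOn ℂ (siegelUnit x) {τ : ℂ | 0 < τ.im} := fun τ hτ =>
    (differentiableAt_siegelUnit x hτ).differentiableWithinAt
  have hne : ∀ y ∈ Ioi (0 : ℝ), siegelUnit x (Complex.I * y) ≠ 0 := fun y hy =>
    siegelUnit_ne_zero hx (im_I_mul_pos hy)
  exact ((contDiffOn_comp_I_mul hd).norm ℝ hne).log fun y hy => norm_ne_zero_iff.2 (hne y hy)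

lemma hasDerivAt_log_norm {f : ℝ → ℂ} {f' : ℂ} {y : ℝ} (hf : HasDerivAt f f' y) (h0 : f y ≠ 0) :
    HasDerivAt (fun y => Real.log ‖f y‖) (f' / f y).re y := by
  have h1 := (hf.norm_sq.log (pow_ne_zero 2 (norm_ne_zero_iff.2 h0))).const_mul (1 / 2)
  have h2 : (fun y => 1 / 2 * Real.log (‖f y‖ ^ 2)) = fun y => Real.log ‖f y‖ := by
    funext y
    rw [Real.log_pow]
    push_cast
    ring
  rw [h2] at h1
  refine h1.congr_deriv ?_
  rw [Complex.inner, ← Complex.normSq_eq_norm_sq, Complex.div_re]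
  simp
  ring

lemma hasDerivAt_logAbsSiegel (hx : NotIntegral x) {y : ℝ} (hy : 0 < y) :
    HasDerivAt (logAbsSiegel x) (dlogSiegel x y).re y := by
  have him := im_I_mul_pos hy
  have h1 : HasDerivAt (fun s : ℝ => Complex.I * (s : ℂ)) (Complex.I * 1) y :=
    (Complex.ofRealCLM.hasDerivAt (x := y)).const_mul Complex.I
  have h2 : HasDerivAt (fun s : ℝ => siegelUnit x (Complex.I * s))
      (deriv (siegelUnit x) (Complex.I * y) * (Complex.I * 1)) y :=
    (differentiableAt_siegelUnit x him).hasDerivAt.comp_of_eq y h1 rfl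
  have h3 := hasDerivAt_log_norm h2 (siegelUnit_ne_zero hx him)
  refine h3.congr_deriv ?_
  rw [dlogSiegel, logDeriv_apply]
  congr 1
  ring

/-- The constant term at infinity of `log |g_x|`. -/
noncomputable def siegelConst (x : ℝ × ℝ) : ℝ :=
  if Int.fract x.1 = 0 then Real.log ‖1 - expTwoPiI x.2‖ else 0

/-- The slope at infinity of `log |g_x|`. -/
noncomputable def siegelSlope (x : ℝ × ℝ) : ℝ :=
  -(2 * Real.pi * ((Int.fract x.1 ^ 2 - Int.fract x.1 + 1 / 6) / 2))

lemma logAbsSiegel_eq (hx : NotIntegral x) {y : ℝ} (hy : 0 < y) :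
    logAbsSiegel x y = siegelSlope x * y +
      Real.log ‖siegelProd (Int.fract x.1) (expTwoPiI x.2) (Complex.I * y)‖ +
      Real.log ‖siegelProd (1 - Int.fract x.1) (expTwoPiI (-x.2)) (Complex.I * y)‖ := by
  have hτ := im_I_mul_pos hy
  have n1 := siegelProd_ne_zero (Int.fract_nonneg x.1) (norm_expTwoPiI_ofReal x.2)
    hx.pos_or_ne_one hτ
  have n2 := siegelProd_ne_zero (one_sub_fract_pos x.1).le (norm_expTwoPiI_neg_ofReal x.2)
    (Or.inl (one_sub_fract_pos x.1)) hτ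
  rw [logAbsSiegel, siegelUnit_eq, norm_mul, norm_mul, norm_expTwoPiI, Real.log_mul
    (mul_ne_zero (Real.exp_ne_zero _) (norm_ne_zero_iff.2 n1)) (norm_ne_zero_iff.2 n2),
    Real.log_mul (Real.exp_ne_zero _) (norm_ne_zero_iff.2 n1), Real.log_exp,
    Complex.im_ofReal_mul, siegelSlope]
  simp
  ring

lemma expDecay_logAbsSiegel (hx : NotIntegral x) :
    ExpDecay fun y => (logAbsSiegel x y : ℂ) - (siegelSlope x * y + siegelConst x) := by
  have h2 := (expDecay_siegelProd_sub_one (one_sub_fract_pos x.1)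
    (norm_expTwoPiI_neg_ofReal x.2)).log_norm
  by_cases h0 : Int.fract x.1 = 0
  · have h1 := (expDecay_siegelProd_sub_one one_pos (norm_expTwoPiI_ofReal x.2)).log_norm
    refine (h1.add h2).congr' fun y hy => ?_
    have hτ := im_I_mul_pos hy
    have hne : expTwoPiI x.2 ≠ 1 := by
      rcases hx.pos_or_ne_one with h | h
      · exact absurd h0 h.ne'
      · exact h
    have hne' := siegelProd_ne_zero zero_le_one (norm_expTwoPiI_ofReal x.2) (Or.inl one_pos) hτ
    rw [logAbsSiegel_eq hx hy, siegelConst, if_pos h0, h0,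
      siegelProd_zero (norm_expTwoPiI_ofReal x.2) hτ, norm_mul,
      Real.log_mul (norm_ne_zero_iff.2 (sub_ne_zero.2 hne.symm)) (norm_ne_zero_iff.2 hne')]
    push_cast
    ring
  · have h1 := (expDecay_siegelProd_sub_one (lt_of_le_of_ne (Int.fract_nonneg _) (Ne.symm h0))
      (norm_expTwoPiI_ofReal x.2)).log_norm
    refine (h1.add h2).congr' fun y hy => ?_
    rw [logAbsSiegel_eq hx hy, siegelConst, if_neg h0]
    push_cast
    ring

lemma expDecay_dlogSiegel (hx : NotIntegral x) :
    ExpDecay fun y => dlogSiegel x y - siegelSlope x := by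
  have h1 := expDecay_lambertSum (Int.fract_nonneg x.1) (norm_expTwoPiI_ofReal x.2)
  have h2 := expDecay_lambertSum (one_sub_fract_pos x.1).le (norm_expTwoPiI_neg_ofReal x.2)
  refine ((h1.add h2).const_mul (2 * Real.pi)).congr' fun y hy => ?_
  rw [dlogSiegel, logDeriv_siegelUnit hx (im_I_mul_pos hy),
    eisenstein_two_eq (im_I_mul_pos hy) hx, siegelSlope]
  push_cast
  linear_combination (-(2 * Real.pi) * ((((Int.fract x.1 : ℝ) : ℂ) ^ 2 - (Int.fract x.1 : ℝ) + 1 / 6) / 2 -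
    lambertSum (Int.fract x.1) (expTwoPiI x.2) (Complex.I * y) -
    lambertSum (1 - Int.fract x.1) (expTwoPiI (-x.2)) (Complex.I * y)) : ℂ) * Complex.I_sq

lemma isLogForm_dlogSiegel (hx : NotIntegral x) :
    IsLogForm (dlogSiegel x) (logAbsSiegel x) (siegelSlope x) (siegelConst x) where
  cont := (contDiffOn_dlogSiegel hx).continuousOn
  deriv _ hy := hasDerivAt_logAbsSiegel hx hy
  decay := expDecay_dlogSiegel hx
  decay_log := expDecay_logAbsSiegel hx

end SiegelUnit

/-! ### The Kronecker limit formula at the point `i` -/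

lemma log_norm_tprod_one_sub {z : ℕ → ℂ} (hz : ∀ j, ‖z j‖ < 1) (hs : Summable z) :
    Real.log ‖∏' j, (1 - z j)‖ = (∑' j, Complex.log (1 - z j)).re := by
  have h0 : ∀ j, 1 - z j ≠ 0 := by
    intro j h
    have h1 := hz j
    rw [← sub_eq_zero.1 h, norm_one] at h1
    exact lt_irrefl _ h1
  have h2 : Summable fun j => Complex.log (1 - z j) := by
    simpa only [sub_eq_add_neg] using Complex.summable_log_one_add_of_summable hs.neg
  rw [← Complex.cexp_tsum_eq_tprod h0 h2, Complex.norm_exp, Real.log_exp]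

/-- Summation of `-log (1 - z) = ∑ z ^ k / k` over a summable family, with the two summations
interchanged. The terms with `k = 0` vanish, as divisions by zero. -/
lemma hasSum_tsum_pow_div {z : ℕ → ℂ} {r : ℝ} (hr : r < 1) (hz : ∀ j, ‖z j‖ ≤ r)
    (hs : Summable fun j => ‖z j‖) :
    HasSum (fun k : ℕ => ∑' j, z j ^ k / k) (-∑' j, Complex.log (1 - z j)) := by
  have hr0 : 0 ≤ r := (norm_nonneg _).trans (hz 0)
  have hgeo : Summable fun k : ℕ => r ^ (k - 1) :=
    (summable_nat_add_iff 1).1 (by simpa using summable_geometric_of_lt_one hr0 hr)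
  have hsum : Summable fun p : ℕ × ℕ => z p.1 ^ p.2 / p.2 := by
    refine Summable.of_norm_bounded
      (hs.mul_of_nonneg hgeo (fun _ => norm_nonneg _) fun k => by positivity) fun p => ?_
    obtain ⟨j, k⟩ := p
    rcases k with _ | k
    · simp only [Nat.cast_zero, div_zero, norm_zero]
      positivity
    · rw [norm_div, norm_pow, Complex.norm_natCast, pow_succ']
      calc ‖z j‖ * ‖z j‖ ^ k / (k + 1 : ℕ) ≤ ‖z j‖ * ‖z j‖ ^ k := by
            refine div_le_self (by positivity) ?_
            exact_mod_cast Nat.le_add_left 1 k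
        _ ≤ ‖z j‖ * r ^ k := by
            gcongr
            exact hz j
  have h1 : ∀ j, HasSum (fun k : ℕ => z j ^ k / k) (-Complex.log (1 - z j)) := fun j =>
    Complex.hasSum_taylorSeries_neg_log ((hz j).trans_lt hr)
  set f : ℕ → ℕ → ℂ := fun j k => z j ^ k / k with hf
  have hsum' : Summable (Function.uncurry f) := hsum
  have h2 : Summable fun k : ℕ => ∑' j, f j k := hsum'.prod_symm.prod
  have h3 : ∑' k : ℕ, ∑' j, f j k = ∑' j, ∑' k, f j k := hsum'.tsum_comm
  rw [tsum_congr fun j => (h1 j).tsum_eq, tsum_neg] at h3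
  rw [← h3]
  exact h2.hasSum

/-- The sum `∑_k ∑_j (Q_j ^ k + conj (Q_j) ^ k) / k` over the terms `Q_j` of the infinite product
at `τ = i`, split into its two halves. -/
lemma exists_hasSum_siegelFactor {β : ℝ} {ζ : ℂ} (hβ : 0 < β) (hζ : ‖ζ‖ = 1) :
    ∃ L : ℂ, HasSum (fun k : ℕ => ∑' j : ℕ, (expTwoPiI ((β + j : ℝ) * Complex.I) * ζ) ^ k / k) L ∧
      HasSum (fun k : ℕ => ∑' j : ℕ, (expTwoPiI ((β + j : ℝ) * Complex.I) * ζ⁻¹) ^ k / k)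
        (conj L) ∧ L + conj L = -2 * (Real.log ‖siegelProd β ζ Complex.I‖ : ℂ) := by
  have hτ : 0 < Complex.I.im := by simp
  set z : ℕ → ℂ := fun j => expTwoPiI ((β + j : ℝ) * Complex.I) * ζ with hz
  have hsum : Summable fun j => ‖z j‖ := by
    simpa only [norm_neg] using summable_norm_siegelFactor hβ.le hζ hτ
  set r : ℝ := Real.exp (-(2 * Real.pi * β)) with hr
  have hr1 : r < 1 := by
    rw [hr, Real.exp_lt_one_iff, neg_lt_zero]
    positivity
  have hzr : ∀ j, ‖z j‖ ≤ r := by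
    intro j
    rw [hz, norm_siegelFactor hζ, hr, Real.exp_le_exp, Complex.I_im, mul_one, neg_le_neg_iff]
    gcongr
    exact le_add_of_nonneg_right j.cast_nonneg
  have h := hasSum_tsum_pow_div hr1 hzr hsum
  refine ⟨_, h, ?_, ?_⟩
  · have hc := Complex.hasSum_conj'.2 h
    refine hc.congr_fun fun k => ?_
    rw [Complex.conj_tsum]
    refine tsum_congr fun j => ?_
    rw [map_div₀, map_pow, Complex.conj_natCast, hz, map_mul, ← Complex.inv_eq_conj hζ, expTwoPiI,
      ← Complex.exp_conj]
    congr 3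
    simp only [map_mul, Complex.conj_I, Complex.conj_ofReal, map_ofNat]
    ring_nf
  · rw [Complex.add_conj, siegelProd,
      log_norm_tprod_one_sub (fun j => (hzr j).trans_lt hr1) hsum.of_norm]
    push_cast
    rw [Complex.neg_re]
    push_cast
    ring

/-- The summand `χ(m, n) / |m i + n|²` of the Kronecker limit formula at `τ = i`. -/
noncomputable def kroneckerTerm (x : ℝ × ℝ) (w : ℤ × ℤ) : ℂ :=
  latticeChar x w / ((w.1 : ℂ) ^ 2 + (w.2 : ℂ) ^ 2)

lemma kroneckerTerm_rotate (x : ℝ × ℝ) (m n : ℤ) :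
    kroneckerTerm x (m, n) = kroneckerTerm (x.2, -x.1) (n, -m) := by
  simp only [kroneckerTerm, latticeChar]
  push_cast
  ring_nf

lemma hasSum_kroneckerTerm_row_zero (x : ℝ × ℝ) :
    HasSum (fun n : ℤ => kroneckerTerm x (0, n)) (-2 * Real.pi * siegelSlope x) := by
  have h := hasSum_bernoulli_two (x := Int.fract x.1) ⟨Int.fract_nonneg _, Int.fract_lt_one _⟩
  convert! h using 1
  · funext n
    simp [kroneckerTerm, latticeChar_eq_fract, expTwoPiI_zero]
  · rw [siegelSlope]
    push_cast
    ring

/-- The sum over the row `m = k` (for `ζ = e(x₂)`) or `m = -k` (for `ζ = e(-x₂)`) of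
`kroneckerTerm`, divided by `π`, if `k ≠ 0`. For `k = 0` it is `0`, because of the division by
zero. -/
noncomputable def kroneckerRow (x : ℝ × ℝ) (ζ : ℂ) (k : ℕ) : ℂ :=
  (∑' j : ℕ, (expTwoPiI ((Int.fract x.1 + j : ℝ) * Complex.I) * ζ) ^ k / k) +
    ∑' j : ℕ, (expTwoPiI ((1 - Int.fract x.1 + j : ℝ) * Complex.I) * ζ) ^ k / k

lemma summable_siegelFactor_pow_div {β : ℝ} {ζ : ℂ} (hβ : 0 ≤ β) (hζ : ‖ζ‖ = 1) {k : ℕ}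
    (hk : k ≠ 0) :
    Summable fun j : ℕ => (expTwoPiI ((β + j : ℝ) * Complex.I) * ζ) ^ k / k := by
  have h := summable_norm_siegelFactor hβ (ζ := 1) norm_one (τ := k * Complex.I)
    (by simpa using Nat.pos_of_ne_zero hk)
  refine Summable.of_norm ((h.mul_right (1 / k : ℝ)).congr fun j => ?_)
  rw [norm_neg, mul_one, norm_div, norm_pow, norm_mul, hζ, mul_one, Complex.norm_natCast,
    ← norm_pow, ← expTwoPiI_nat_mul]
  ring_nf

lemma hasSum_kroneckerTerm_row {x : ℝ × ℝ} {m : ℤ} {k : ℕ} (hk : k ≠ 0)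
    (hm : (m : ℂ) ^ 2 = (k : ℂ) ^ 2) {ζ : ℂ} (hζ : ‖ζ‖ = 1)
    (hmζ : expTwoPiI (m * x.2) = ζ ^ k) :
    HasSum (fun n : ℤ => kroneckerTerm x (m, n)) (Real.pi * kroneckerRow x ζ k) := by
  have hk0 : (0 : ℝ) < k := by exact_mod_cast Nat.pos_of_ne_zero hk
  have h := (hasSum_poissonKernel hk0 (x := Int.fract x.1)
    ⟨Int.fract_nonneg _, Int.fract_lt_one _⟩).mul_left (ζ ^ k)
  convert! h using 1
  · funext n
    rw [kroneckerTerm, latticeChar_eq_fract, hmζ, hm, mul_div_assoc]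
    simp
  · have s1 := summable_siegelFactor_pow_div (Int.fract_nonneg x.1) hζ hk
    have s2 := summable_siegelFactor_pow_div (one_sub_fract_pos x.1).le hζ hk
    rw [kroneckerRow, ← s1.tsum_add s2, ← tsum_mul_left, ← tsum_mul_left, ← tsum_mul_left]
    refine tsum_congr fun j => ?_
    have e : ∀ t : ℝ, expTwoPiI (t * (Complex.I * (k : ℝ))) = expTwoPiI (t * Complex.I) ^ k := by
      intro t
      rw [← expTwoPiI_nat_mul]
      push_cast
      ring_nf
    rw [e, e, mul_pow, mul_pow]
    push_cast
    ring

lemma summable_kroneckerTerm_row (x : ℝ × ℝ) (m : ℤ) :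
    Summable fun n : ℤ => kroneckerTerm x (m, n) := by
  rcases eq_or_ne m 0 with rfl | hm
  · exact (hasSum_kroneckerTerm_row_zero x).summable
  · have hu : (0 : ℝ) < |(m : ℝ)| := abs_pos.2 (by exact_mod_cast hm)
    refine Summable.of_norm ((summable_one_div_sq_add_sq hu).norm.congr fun n => ?_)
    rw [kroneckerTerm, norm_div, norm_div, norm_latticeChar, norm_one, ← Complex.ofReal_pow, sq_abs]
    push_cast
    rfl

/-- The Kronecker limit formula at `i`, as a sum over rows. The row `m = 0` gives the factor
`q^{B₂/2}` of `g_x`, and the other rows give the logarithms of the two products. -/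
theorem hasSum_kroneckerTerm_rows {x : ℝ × ℝ} (hx : Int.fract x.1 ≠ 0) :
    HasSum (fun m : ℤ => ∑' n : ℤ, kroneckerTerm x (m, n))
      (-2 * Real.pi * logAbsSiegel x 1) := by
  have hβ : 0 < Int.fract x.1 := lt_of_le_of_ne (Int.fract_nonneg _) hx.symm
  obtain ⟨L, h1, h1', hL⟩ := exists_hasSum_siegelFactor hβ (norm_expTwoPiI_ofReal x.2)
  obtain ⟨K, h2, h2', hK⟩ := exists_hasSum_siegelFactor (one_sub_fract_pos x.1)
    (norm_expTwoPiI_neg_ofReal x.2)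
  set ζ := expTwoPiI x.2 with hζ
  rw [expTwoPiI_neg, ← hζ] at h2 h2' hK
  rw [inv_inv] at h2'
  have hrow : HasSum (fun k : ℕ => kroneckerRow x ζ k) (L + conj K) := h1.add h2'
  have hrow' : HasSum (fun k : ℕ => kroneckerRow x ζ⁻¹ k) (conj L + K) := h1'.add h2
  have hζ1 : ‖ζ‖ = 1 := norm_expTwoPiI_ofReal x.2
  -- the row `m = 0` is treated separately
  set R : ℤ → ℂ := fun m => if m = 0 then 0 else ∑' n : ℤ, kroneckerTerm x (m, n) with hR
  have hz : ∀ ξ : ℂ, kroneckerRow x ξ 0 = 0 := by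
    intro ξ
    simp [kroneckerRow]
  have hp : HasSum (fun k : ℕ => R k) (Real.pi * (L + conj K)) := by
    refine (hrow.mul_left (Real.pi : ℂ)).congr_fun fun k => ?_
    rcases eq_or_ne k 0 with rfl | hk
    · simp [hR, hz]
    · simp only [hR, Int.natCast_eq_zero, hk, if_false]
      refine (hasSum_kroneckerTerm_row hk (by simp) hζ1 ?_).tsum_eq
      rw [hζ, ← expTwoPiI_nat_mul]
      simp
  have hn : HasSum (fun k : ℕ => R (-k)) (Real.pi * (conj L + K)) := by
    refine (hrow'.mul_left (Real.pi : ℂ)).congr_fun fun k => ?_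
    rcases eq_or_ne k 0 with rfl | hk
    · simp [hR, hz]
    · simp only [hR, neg_eq_zero, Int.natCast_eq_zero, hk, if_false]
      refine (hasSum_kroneckerTerm_row hk (by simp) (by rw [norm_inv, hζ1, inv_one]) ?_).tsum_eq
      rw [hζ, ← expTwoPiI_neg, ← expTwoPiI_nat_mul]
      simp
  have h := (hp.of_nat_of_neg hn).add
    (hasSum_ite_eq (0 : ℤ) (-2 * Real.pi * siegelSlope x : ℂ))
  have hsl := logAbsSiegel_eq (x := x) (Or.inl hx) one_pos
  rw [Complex.ofReal_one, mul_one, mul_one] at hsl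
  convert! h using 1
  · funext m
    rcases eq_or_ne m 0 with rfl | hm
    · simp [hR, (hasSum_kroneckerTerm_row_zero x).tsum_eq]
    · simp [hR, hm]
  · rw [hsl, expTwoPiI_neg, ← hζ]
    push_cast
    have hR0 : R 0 = 0 := by simp [hR]
    rw [hR0]
    linear_combination (-Real.pi : ℂ) * hL - (Real.pi : ℂ) * hK

/-- The twisted differences of the Kronecker limit series are `O(|w|⁻³)`. -/
lemma summable_kroneckerTerm_sub (x : ℝ × ℝ) (v : ℤ × ℤ) :
    Summable fun w => kroneckerTerm x w - latticeChar x v * kroneckerTerm x (w - v) := by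
  have hτ : 0 < Complex.I.im := by simp
  have hnorm : ∀ w : ℤ × ℤ, ((w.1 : ℂ) ^ 2 + (w.2 : ℂ) ^ 2)⁻¹ =
      ((‖latticePoint Complex.I w‖ : ℝ) : ℂ) ^ (-2 : ℂ) := by
    intro w
    have h : ‖latticePoint Complex.I w‖ ^ 2 = (w.1 : ℝ) ^ 2 + (w.2 : ℝ) ^ 2 := by
      rw [Complex.sq_norm, Complex.normSq_apply]
      simp [latticePoint]
      ring
    rw [Complex.cpow_neg, Complex.cpow_ofNat, ← Complex.ofReal_pow, h]
    push_cast
    rfl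
  set V := ‖latticePoint Complex.I v‖ with hV
  refine Summable.of_norm_bounded_eventually
    ((summable_norm_latticePoint_rpow hτ (r := 3) (by norm_num)).mul_left (16 * V)) ?_
  filter_upwards [eventually_le_norm_latticePoint hτ (2 * V + 1)] with w hw
  have hV0 : 0 ≤ V := norm_nonneg _
  set a := ‖latticePoint Complex.I w‖ with ha
  set b := ‖latticePoint Complex.I (w - v)‖ with hb
  have hab : |a - b| ≤ V := by
    have h := abs_norm_sub_norm_le (latticePoint Complex.I w) (latticePoint Complex.I (w - v))
    rw [latticePoint_sub, sub_sub_cancel, ← latticePoint_sub] at h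
    exact h
  have hab' := abs_le.1 hab
  have h := norm_cpow_neg_sub_le (s := 2) (M := 2) (a := a) (b := b) (ρ := a / 2) (by norm_num)
    (by simp) (by linarith) (by linarith) (by linarith)
  have h3 : (a / 2) ^ (-(2 : ℂ).re - 1) = 8 * a ^ (-3 : ℝ) := by
    rw [Real.div_rpow (by linarith) two_pos.le]
    norm_num
    ring
  calc ‖kroneckerTerm x w - latticeChar x v * kroneckerTerm x (w - v)‖
      = ‖latticeChar x w * ((a : ℂ) ^ (-2 : ℂ) - (b : ℂ) ^ (-2 : ℂ))‖ := by
        rw [kroneckerTerm, kroneckerTerm, div_eq_mul_inv, div_eq_mul_inv, hnorm, hnorm,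
          latticeChar_eq_mul x w v, ← ha, ← hb]
        ring_nf
    _ ≤ 2 * (a / 2) ^ (-(2 : ℂ).re - 1) * |a - b| := by
        rw [norm_mul, norm_latticeChar, one_mul]
        exact h
    _ ≤ 16 * V * a ^ (-3 : ℝ) := by
        rw [h3]
        have : 0 ≤ a ^ (-3 : ℝ) := by positivity
        nlinarith

/-- The invariance of `|g_x|` under `τ ↦ -1/τ`, at the fixed point `i`: both sides are the value of
the same conditionally convergent double series, summed in the two possible orders. -/
theorem logAbsSiegel_rotate_one {x : ℝ × ℝ} (h1 : Int.fract x.1 ≠ 0) (h2 : Int.fract x.2 ≠ 0) :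
    logAbsSiegel (x.2, -x.1) 1 = logAbsSiegel x 1 := by
  obtain ⟨v, hv⟩ := exists_latticeChar_ne_one (x := x) (Or.inl h1)
  have hr := hasSum_kroneckerTerm_rows h1
  have hcol : ∀ n : ℤ, ∑' m : ℤ, kroneckerTerm x (m, n) =
      ∑' m : ℤ, kroneckerTerm (x.2, -x.1) (n, m) := by
    intro n
    rw [← (Equiv.neg ℤ).tsum_eq]
    refine tsum_congr fun m => ?_
    rw [kroneckerTerm_rotate, Equiv.neg_apply, neg_neg]
  have hc : HasSum (fun n : ℤ => ∑' m : ℤ, kroneckerTerm x (m, n))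
      (-2 * Real.pi * logAbsSiegel (x.2, -x.1) 1) := by
    simp only [hcol]
    exact hasSum_kroneckerTerm_rows (x := (x.2, -x.1)) h2
  have h := tsum_tsum_comm_of_shift hv (summable_kroneckerTerm_sub x v)
    (summable_kroneckerTerm_row x) hr.summable (fun n => ?_) hc.summable
  · rw [hr.tsum_eq, hc.tsum_eq] at h
    have hpi : (-2 * Real.pi : ℂ) ≠ 0 := by simp [Real.pi_ne_zero]
    exact_mod_cast (mul_left_cancel₀ hpi h).symm
  · have h := summable_kroneckerTerm_row (x.2, -x.1) n
    rw [← (Equiv.neg ℤ).summable_iff] at h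
    refine h.congr fun m => ?_
    rw [kroneckerTerm_rotate]
    rfl

/-! ### Behaviour at the cusp `0` -/

section Cusp

variable {x : ℝ × ℝ}

lemma hasDerivAt_logAbsSiegel_inv (hx : NotIntegral x) {y : ℝ} (hy : 0 < y) :
    HasDerivAt (fun y => logAbsSiegel x (1 / y)) (dlogSiegel (x.2, -x.1) y).re y := by
  have h1 : HasDerivAt (fun y : ℝ => 1 / y) (-(y ^ 2)⁻¹) y := by
    simpa only [one_div] using hasDerivAt_inv hy.ne'
  have h2 := (hasDerivAt_logAbsSiegel hx (one_div_pos.2 hy)).comp y h1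
  have h3 := congrFun (pullbackSigma_ofReal_re (dlogSiegel x)) y
  rw [pullbackSigma_dlogSiegel hx hy, pullbackSigma] at h3
  have h4 : (dlogSiegel x (1 / y)).re * -(y ^ 2)⁻¹ = (dlogSiegel (x.2, -x.1) y).re := by
    have h5 : ((((dlogSiegel x (1 / y)).re * -(y ^ 2)⁻¹ : ℝ)) : ℂ) =
        -((dlogSiegel x (1 / y)).re : ℂ) / (y : ℂ) ^ 2 := by
      push_cast
      ring
    exact_mod_cast h5.trans h3
  rw [h4] at h2
  exact h2

/-- The defect of the invariance of `log |g_x|` under `τ ↦ -1/τ`, as read off at `τ = i`. -/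
noncomputable def inversionDefect (x : ℝ × ℝ) : ℝ :=
  logAbsSiegel x 1 - logAbsSiegel (x.2, -x.1) 1

lemma inversionDefect_eq_zero (h1 : Int.fract x.1 ≠ 0) (h2 : Int.fract x.2 ≠ 0) :
    inversionDefect x = 0 := by
  rw [inversionDefect, logAbsSiegel_rotate_one h1 h2, sub_self]

/-- The functions `log |g_x(-1/τ)|` and `log |g_{x'}(τ)|`, where `x' = (x₂, -x₁)`, have the same
derivative, so that they differ by a constant. -/
lemma logAbsSiegel_inv (hx : NotIntegral x) {y : ℝ} (hy : 0 < y) :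
    logAbsSiegel x (1 / y) = logAbsSiegel (x.2, -x.1) y + inversionDefect x := by
  have hd : ∀ t ∈ Ioi (0 : ℝ), HasDerivAt
      (fun y => logAbsSiegel x (1 / y) - logAbsSiegel (x.2, -x.1) y) 0 t := by
    intro t ht
    have h := (hasDerivAt_logAbsSiegel_inv hx ht).sub (hasDerivAt_logAbsSiegel hx.rotate ht)
    rw [sub_self] at h
    exact h
  have h := isOpen_Ioi.is_const_of_deriv_eq_zero (convex_Ioi (0 : ℝ)).isPreconnected
    (fun t ht => (hd t ht).differentiableAt.differentiableWithinAt)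
    (fun t ht => (hd t ht).deriv) (mem_Ioi.2 hy) (mem_Ioi.2 one_pos)
  simp only [div_one] at h
  rw [inversionDefect]
  linarith

lemma isLogForm_pullbackSigma_dlogSiegel (hx : NotIntegral x) :
    IsLogForm (pullbackSigma (dlogSiegel x)) (fun y => logAbsSiegel x (1 / y))
      (siegelSlope (x.2, -x.1)) (siegelConst (x.2, -x.1) + inversionDefect x) where
  cont := (contDiffOn_dlogSiegel hx.rotate).continuousOn.congr fun _ hy =>
    pullbackSigma_dlogSiegel hx hy
  deriv y hy := by
    rw [pullbackSigma_dlogSiegel hx hy]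
    exact hasDerivAt_logAbsSiegel_inv hx hy
  decay := (expDecay_dlogSiegel hx.rotate).congr' fun y hy => by
    rw [pullbackSigma_dlogSiegel hx hy]
  decay_log := (expDecay_logAbsSiegel hx.rotate).congr' fun y hy => by
    rw [logAbsSiegel_inv hx hy]
    push_cast
    ring

/-! ### Admissibility -/

lemma AdmissibleAtInfty.congr {φ ψ : ℝ → ℂ} (h : AdmissibleAtInfty φ)
    (heq : ∀ y, 0 < y → ψ y = φ y) : AdmissibleAtInfty ψ := by
  obtain ⟨hs, P, hP⟩ := h
  rw [hasPolyPart_iff] at hP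
  exact AdmissibleAtInfty.of_expDecay (hs.congr heq) P (hP.congr' fun y hy => by rw [heq y hy])

lemma AdmissibleAtInfty.of_expDecay_sub_const {φ : ℝ → ℂ} (hs : ContDiffOn ℝ ∞ φ (Ioi 0)) (k : ℂ)
    (h : ExpDecay fun y => φ y - k) : AdmissibleAtInfty φ :=
  AdmissibleAtInfty.of_expDecay hs (Polynomial.C k) (by simpa using h)

lemma contDiffOn_ofReal_re {f : ℝ → ℂ} {s : Set ℝ} (hf : ContDiffOn ℝ ∞ f s) :
    ContDiffOn ℝ ∞ (fun y => ((f y).re : ℂ)) s :=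
  (Complex.ofRealCLM.contDiff.comp Complex.reCLM.contDiff).comp_contDiffOn hf

lemma contDiffOn_ofReal_im {f : ℝ → ℂ} {s : Set ℝ} (hf : ContDiffOn ℝ ∞ f s) :
    ContDiffOn ℝ ∞ (fun y => ((f y).im : ℂ)) s :=
  (Complex.ofRealCLM.contDiff.comp Complex.imCLM.contDiff).comp_contDiffOn hf

lemma contDiffOn_ofReal_logAbsSiegel (hx : NotIntegral x) :
    ContDiffOn ℝ ∞ (fun y => (logAbsSiegel x y : ℂ)) (Ioi 0) :=
  Complex.ofRealCLM.contDiff.comp_contDiffOn (contDiffOn_logAbsSiegel hx)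

lemma admissibleAtInfty_eisensteinForm (hx : NotIntegral x) :
    AdmissibleAtInfty (eisensteinForm 2 x) := by
  refine AdmissibleAtInfty.congr (φ := fun y => (2 * Real.pi * Complex.I)⁻¹ * dlogSiegel x y) ?_
    fun y hy => eisensteinForm_eq hx hy
  refine AdmissibleAtInfty.of_expDecay_sub_const (contDiffOn_const.mul (contDiffOn_dlogSiegel hx))
    ((2 * Real.pi * Complex.I)⁻¹ * siegelSlope x) ?_
  simpa only [mul_sub] using (expDecay_dlogSiegel hx).const_mul (2 * Real.pi * Complex.I)⁻¹

lemma admissibleForm_eisensteinForm (hx : NotIntegral x) : AdmissibleForm (eisensteinForm 2 x) :=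
  ⟨admissibleAtInfty_eisensteinForm hx, (admissibleAtInfty_eisensteinForm hx.rotate).congr
    fun _ hy => pullbackSigma_eisensteinForm hx hy⟩

lemma admissibleAtInfty_omegaPlus (hx : NotIntegral x) : AdmissibleAtInfty (omegaPlus x) :=
  AdmissibleAtInfty.of_expDecay_sub_const (contDiffOn_ofReal_re (contDiffOn_dlogSiegel hx))
    (siegelSlope x) (by simpa [omegaPlus] using (expDecay_dlogSiegel hx).re)

lemma admissibleForm_omegaPlus (hx : NotIntegral x) : AdmissibleForm (omegaPlus x) := by
  refine ⟨admissibleAtInfty_omegaPlus hx,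
    (admissibleAtInfty_omegaPlus hx.rotate).congr fun y hy => ?_⟩
  have h := congrFun (pullbackSigma_ofReal_re (dlogSiegel x)) y
  rw [pullbackSigma_dlogSiegel hx hy] at h
  exact h

lemma admissibleAtInfty_omegaMinus (hx : NotIntegral x) : AdmissibleAtInfty (omegaMinus x) :=
  AdmissibleAtInfty.of_expDecay_sub_const (contDiffOn_ofReal_im (contDiffOn_dlogSiegel hx)) 0
    (by simpa [omegaMinus] using (expDecay_dlogSiegel hx).im)

lemma admissibleForm_omegaMinus (hx : NotIntegral x) : AdmissibleForm (omegaMinus x) := by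
  refine ⟨admissibleAtInfty_omegaMinus hx,
    (admissibleAtInfty_omegaMinus hx.rotate).congr fun y hy => ?_⟩
  have h := congrFun (pullbackSigma_ofReal_im (dlogSiegel x)) y
  rw [pullbackSigma_dlogSiegel hx hy] at h
  exact h

lemma hasPolyPart_logAbsSiegel (hx : NotIntegral x) :
    HasPolyPart (fun y => (logAbsSiegel x y : ℂ))
      (Polynomial.C (siegelSlope x : ℂ) * Polynomial.X + Polynomial.C (siegelConst x : ℂ)) :=
  hasPolyPart_iff.2 (by simpa using expDecay_logAbsSiegel hx)

lemma siegelReg_eq (hx : NotIntegral x) : siegelReg x = siegelConst x := by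
  rw [siegelReg, regValue, polyPart_eq (hasPolyPart_logAbsSiegel hx)]
  simp

lemma eta_eq_etaForm (a b : ℝ × ℝ) :
    eta a b = etaForm (dlogSiegel a) (dlogSiegel b) (logAbsSiegel a) (logAbsSiegel b) := rfl

lemma admissibleForm_eta {a b : ℝ × ℝ} (ha : NotIntegral a) (hb : NotIntegral b) :
    AdmissibleForm (eta a b) := by
  constructor
  · refine AdmissibleAtInfty.of_expDecay_sub_const ?_ 0 (by
      simpa [eta_eq_etaForm] using (isLogForm_dlogSiegel ha).decay_eta (isLogForm_dlogSiegel hb))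
    exact ((contDiffOn_ofReal_logAbsSiegel ha).mul
      (contDiffOn_ofReal_im (contDiffOn_dlogSiegel hb))).sub
      ((contDiffOn_ofReal_logAbsSiegel hb).mul (contDiffOn_ofReal_im (contDiffOn_dlogSiegel ha)))
  · rw [eta_eq_etaForm, pullbackSigma_etaForm]
    refine AdmissibleAtInfty.of_expDecay_sub_const ?_ 0 (by
      simpa using (isLogForm_pullbackSigma_dlogSiegel ha).decay_eta
        (isLogForm_pullbackSigma_dlogSiegel hb))
    have hl : ∀ {x : ℝ × ℝ}, NotIntegral x →
        ContDiffOn ℝ ∞ (fun y => (logAbsSiegel x (1 / y) : ℂ)) (Ioi 0) := fun {x} hx =>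
      (((contDiffOn_ofReal_logAbsSiegel hx.rotate).add
        (contDiffOn_const (c := (inversionDefect x : ℂ)))).congr fun y hy => by
          rw [logAbsSiegel_inv hx hy, Complex.ofReal_add])
    have him : ∀ {x : ℝ × ℝ}, NotIntegral x →
        ContDiffOn ℝ ∞ (fun y => ((pullbackSigma (dlogSiegel x) y).im : ℂ)) (Ioi 0) :=
      fun {x} hx => contDiffOn_ofReal_im ((contDiffOn_dlogSiegel hx.rotate).congr fun y hy =>
        pullbackSigma_dlogSiegel hx hy)
    exact ((hl ha).mul (him hb)).sub ((hl hb).mul (him ha))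

end Cusp

/-! ### The regulator integral -/

theorem regIter_eta {a b : ℝ × ℝ} (ha : NotIntegral a) (hb : NotIntegral b) :
    regIter [eta a b] = ((multipleEisensteinValue [a, b]).im : ℂ)
      - lambdaPlus a * lambdaMinus b + siegelReg a * lambdaMinus b
      - siegelReg b * lambdaMinus a := by
  have hpi : (2 * Real.pi * Complex.I : ℂ) ≠ 0 := by simp [Real.pi_ne_zero]
  rw [siegelReg_eq ha, siegelReg_eq hb]
  exact (isLogForm_dlogSiegel ha).regIter_etaForm (isLogForm_pullbackSigma_dlogSiegel ha)
    (isLogForm_dlogSiegel hb) (isLogForm_pullbackSigma_dlogSiegel hb) (mul_inv_cancel₀ hpi)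
    (fun _ hy => eisensteinForm_eq ha hy) fun _ hy => eisensteinForm_eq hb hy

/-- If no coordinate is integral, then `log |g_x|` has regularised value `0` at both cusps. -/
lemma lambdaPlus_eq_zero {x : ℝ × ℝ} (h1 : Int.fract x.1 ≠ 0) (h2 : Int.fract x.2 ≠ 0) :
    lambdaPlus x = 0 := by
  have hx : NotIntegral x := Or.inl h1
  have h := (isLogForm_dlogSiegel hx).regIter_re (isLogForm_pullbackSigma_dlogSiegel hx)
  rw [inversionDefect_eq_zero h1 h2] at h
  simpa [siegelConst, h1, h2] using! h

section Torsion

variable {N : ℕ} [NeZero N]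

lemma fract_val_div (c : ZMod N) : Int.fract ((c.val : ℝ) / N) = c.val / N := by
  have hN : (0 : ℝ) < N := by exact_mod_cast Nat.pos_of_ne_zero (NeZero.ne N)
  rw [Int.fract_eq_self]
  refine ⟨by positivity, (div_lt_one hN).2 ?_⟩
  exact_mod_cast c.val_lt

lemma fract_val_div_eq_zero_iff (c : ZMod N) : Int.fract ((c.val : ℝ) / N) = 0 ↔ c = 0 := by
  rw [fract_val_div, div_eq_zero_iff, Nat.cast_eq_zero, Nat.cast_eq_zero, ZMod.val_eq_zero,
    or_iff_left (NeZero.ne N)]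

lemma notIntegral_torsionPoint {x : ZMod N × ZMod N} (hx : x ≠ 0) :
    NotIntegral (torsionPoint x) := by
  rw [NotIntegral, torsionPoint, Ne, Ne, fract_val_div_eq_zero_iff, fract_val_div_eq_zero_iff]
  by_contra! h
  exact hx (Prod.ext h.1 h.2)

lemma siegelConst_torsionPoint (x : ZMod N × ZMod N) :
    siegelConst (torsionPoint x) =
      if x.1 = 0 then Real.log ‖1 - expTwoPiI ((torsionPoint x).2 : ℂ)‖ else 0 := by
  simp only [siegelConst, torsionPoint, fract_val_div_eq_zero_iff]

end Torsion

end ModularRegulator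

theorem proposition4p1 (N : ℕ) [NeZero N] (a b : ZMod N × ZMod N) (ha : a ≠ 0) (hb : b ≠ 0) :
    -- all forms and functions whose regularisations occur below are admissible, and
    -- the regularised values `R_a`, `R_b` are the real parts of the constant terms of the logarithms
    (∀ x ∈ ({a, b} : Set (ZMod N × ZMod N)),
      AdmissibleForm (eisensteinForm 2 (torsionPoint x)) ∧
      AdmissibleForm (omegaPlus (torsionPoint x)) ∧
      AdmissibleForm (omegaMinus (torsionPoint x)) ∧
      AdmissibleAtInfty (fun y => (logAbsSiegel (torsionPoint x) y : ℂ)) ∧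
      siegelReg (torsionPoint x) =
        if x.1 = 0 then ((Real.log ‖1 - expTwoPiI ((torsionPoint x).2 : ℂ)‖ : ℝ) : ℂ) else 0) ∧
    AdmissibleForm (eta (torsionPoint a) (torsionPoint b)) ∧
    -- the general formula
    regIter [eta (torsionPoint a) (torsionPoint b)] =
      ((multipleEisensteinValue [torsionPoint a, torsionPoint b]).im : ℂ)
        - lambdaPlus (torsionPoint a) * lambdaMinus (torsionPoint b)
        + siegelReg (torsionPoint a) * lambdaMinus (torsionPoint b)
        - siegelReg (torsionPoint b) * lambdaMinus (torsionPoint a) ∧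
    -- the case of non-zero coordinates
    (a.1 ≠ 0 → a.2 ≠ 0 → b.1 ≠ 0 → b.2 ≠ 0 →
      regIter [eta (torsionPoint a) (torsionPoint b)] =
        ((multipleEisensteinValue [torsionPoint a, torsionPoint b]).im : ℂ)) := by
  have hR : ∀ x : ZMod N × ZMod N, x ≠ 0 → siegelReg (torsionPoint x) =
      if x.1 = 0 then ((Real.log ‖1 - expTwoPiI ((torsionPoint x).2 : ℂ)‖ : ℝ) : ℂ) else 0 := by
    intro x hx
    rw [siegelReg_eq (notIntegral_torsionPoint hx), siegelConst_torsionPoint]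
    split_ifs <;> simp
  have ha' := notIntegral_torsionPoint ha
  have hb' := notIntegral_torsionPoint hb
  refine ⟨?_, admissibleForm_eta ha' hb', regIter_eta ha' hb', fun h1 h2 h3 h4 => ?_⟩
  · intro x hx
    have hx0 : x ≠ 0 := by
      rcases hx with rfl | rfl
      exacts [ha, hb]
    have hx' := notIntegral_torsionPoint hx0
    exact ⟨admissibleForm_eisensteinForm hx', admissibleForm_omegaPlus hx',
      admissibleForm_omegaMinus hx',
      ⟨contDiffOn_ofReal_logAbsSiegel hx', _, hasPolyPart_logAbsSiegel hx'⟩, hR x hx0⟩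
  · rw [regIter_eta ha' hb', hR a ha, hR b hb, if_neg h1, if_neg h3,
      lambdaPlus_eq_zero (mt (fract_val_div_eq_zero_iff a.1).1 h1)
        (mt (fract_val_div_eq_zero_iff a.2).1 h2)]
    ring
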